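/- Setting. A utility serves $N\ge 1$ users with unknown coefficients $\alpha_i\in\mathbb R$, $\beta_i>0$. In period $t=1,2,\dots$ it learns a target $d_t$, broadcasts a price $\lambda_t$, and observes the responses $\hat x_i^t(\lambda_t)=x_i(\lambda_t)+\epsilon_i^t$, where $x_i(\lambda)=\frac{N\lambda-\alpha_i}{\beta_i}$ minimizes $\frac1N\big(\tfrac12\beta_i x^2+\alpha_i x\big)-\lambda x$ and the $\epsilon_i^t$ are i.i.d. $\mathcal N(0,\sigma^2)$ with $\sigma>0$. For a fixed capacity $Y>0$ the cost of period $t$ is $$C(\hat x_t,Y)=\frac1N\sum_{i=1}^N\Big(\tfrac12\beta_i(\hat x_i^t)^2+\alpha_i\hat x_i^t\Big)+\frac1{2N}\Big(\sum_{i=1}^N\hat x_i^t-Yd_t\Big)^2 .$$ The full-information optimal price, whose induced responses minimize the expected cost of period $t$, is $\lambda_t^*=\big(Yd_t+\sum_i\frac{\alpha_i}{\beta_i}\big)\big/\big(N+\sum_i\frac N{\beta_i}\big)$. An online pricing algorithm (policy) computes $\lambda_t$ from $N$, $Y$, $d_1,\dots,d_t$ and the past prices and responses $\{\lambda_s,\hat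 x_i^s(\lambda_s): 1\le i\le N,\ 1\le s\le t-1\}$ only. Its gap in period $t$ and its regret over horizon $T$ are $$R_t=\mathbb E\,C(\hat x_t(\lambda_t),Y)-\mathbb E\,C(\hat x_t(\lambda^*_t),Y),\qquad R(T)=\mathbb E\sum_{t=1}^T C(\hat x_t(\lambda_t),Y)-\mathbb E\sum_{t=1}^T C(\hat x_t(\lambda^*_t),Y)=\sum_{t=1}^T R_t ,$$ the expectations being over the noise. Theorem. For every $N\ge1$ there is an online pricing algorithm with the following property. Let $\alpha_{\max}$, $0<\beta_{\min}\le\beta_{\max}$, $0<d_{\min}\le d_{\max}$, $0<Y_{\min}\le Y_{\max}$, $\kappa>0$, $t_0\in\mathbb N$ and $\sigma>0$ be given (the algorithm does not know them). Then there are positive constants $k_1,k_2,K_1,K_2$ and $n_0\in\mathbb N$, depending only on these numbers and on $N$, such that whenever $|\alpha_i|\le\alpha_{\max}$ and $\beta_i\in[\beta_{\min},\beta_{\max}]$ for all $i$, $Y\in[Y_{\min},Y_{\max}]$, $d_t\in[d_{\min},d_{\max}]$ for all $t$, and the targets are spread in the sense that $\frac1t\sum_{s=1}^t\big(d_s-\frac1t\sum_{r=1}^t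 d_r\big)^2\ge\kappa$ for all $t\ge t_0$, all expected costs are finite, $$\frac{k_1}{t}\le R_t\le\frac{k_2}{t}\quad\text{for all } t> n_0,\qquad K_1\log T\le R(T)\le K_2\log T\quad\text{for all } T\ge n_0 .$$ That is, $R_t=\Theta(1/t)$, and the regret is $\Theta(\log T)$, in particular $O(\log T)$. -/

import Mathlib

open MeasureTheory ProbabilityTheory
open scoped NNReal

noncomputable section

namespace DemandResponse

/-- The users' cost coefficients: user `i` has cost `u_i(x) = β_i x ^ 2 / 2 + α_i x`. -/
structure Users (N : ℕ) where
  α : Fin N → ℝ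
  β : Fin N → ℝ

variable {N : ℕ}

/-- The cost `u_i(x) = β_i x ^ 2 / 2 + α_i x` of user `i` for the change in consumption `x`. -/
def Users.userCost (u : Users N) (i : Fin N) (x : ℝ) : ℝ :=
  1 / 2 * u.β i * x ^ 2 + u.α i * x

/-- The (noiseless) response of user `i` to the price `l`, the minimizer of `u_i(x) / N - l x`
(see `Users.response_isMinOn`). -/
def Users.response (u : Users N) (l : ℝ) (i : Fin N) : ℝ :=
  (N * l - u.α i) / u.β i

/-- The cost `C(x, Y)` of one period with target `d`, when the users' responses are `x`:
`(1 / N) ∑ u_i(x_i) + (1 / (2 N)) (∑ x_i - Y d) ^ 2`. -/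
def Users.cost (u : Users N) (Y d : ℝ) (x : Fin N → ℝ) : ℝ :=
  (∑ i, 1 / (N : ℝ) * u.userCost i (x i)) + 1 / (2 * (N : ℝ)) * ((∑ i, x i) - Y * d) ^ 2

/-- The full-information price `λ*` of a period with target `d`. The response that it induces
minimizes the expected cost over all `x` (see `Users.offlinePrice_isMinOn`). -/
def Users.offlinePrice (u : Users N) (Y d : ℝ) : ℝ :=
  (Y * d + ∑ i, u.α i / u.β i) / (N + ∑ i, (N : ℝ) / u.β i)

/-- What the utility has observed during `t` periods: for each of them the price and the
responses of all users. -/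
abbrev History (N t : ℕ) : Type := Fin t → ℝ × (Fin N → ℝ)

/-- An online pricing policy. Periods are numbered `0, 1, 2, …`. The price of period `t` is
computed from the capacity `Y`, the targets of the periods `0, …, t`, and the history of the
periods `0, …, t - 1`. It has no access to the users' coefficients, to the noise or to
future targets. -/
structure PricingPolicy (N : ℕ) where
  price : ℝ → (t : ℕ) → (Fin (t + 1) → ℝ) → History N t → ℝ
  measurable_price : ∀ (Y : ℝ) (t : ℕ) (d : Fin (t + 1) → ℝ), Measurable (price Y t d)

/-- The price of period `t` when the policy is run against the users `u` with capacity `Y`,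
targets `d` and noise realization `e` (`e s i` is added to the response of user `i` in
period `s`). -/
def PricingPolicy.onlinePrice (p : PricingPolicy N) (u : Users N) (Y : ℝ) (d : ℕ → ℝ)
    (e : ℕ → Fin N → ℝ) (t : ℕ) : ℝ :=
  p.price Y t (fun s => d s) (fun s : Fin t =>
    (p.onlinePrice u Y d e s, fun i => u.response (p.onlinePrice u Y d e s) i + e s i))
termination_by t
decreasing_by all_goals exact s.isLt

variable {Ω : Type*} [MeasurableSpace Ω]

/-- The noise variables `ε t i` are independent and identically distributed centred Gaussians
with variance `v`. -/
structure IsGaussianNoise (ε : ℕ → Fin N → Ω → ℝ) (v : ℝ≥0) (P : Measure Ω) : Prop where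
  measurable : ∀ t i, Measurable (ε t i)
  law : ∀ t i, P.map (ε t i) = gaussianReal 0 v
  indep : iIndepFun (fun q : ℕ × Fin N => ε q.1 q.2) P

/-- The random cost of period `t` under the online prices. -/
def onlineCost (p : PricingPolicy N) (u : Users N) (Y : ℝ) (d : ℕ → ℝ)
    (ε : ℕ → Fin N → Ω → ℝ) (t : ℕ) (ω : Ω) : ℝ :=
  u.cost Y (d t) (fun i =>
    u.response (p.onlinePrice u Y d (fun s j => ε s j ω) t) i + ε t i ω)

/-- The random cost of period `t` under the full-information prices. -/
def offlineCost (u : Users N) (Y : ℝ) (d : ℕ → ℝ) (ε : ℕ → Fin N → Ω → ℝ) (t : ℕ) (ω : Ω) : ℝ :=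
  u.cost Y (d t) (fun i => u.response (u.offlinePrice Y (d t)) i + ε t i ω)

/-- The expected gap of period `t` between the online policy and the offline optimum. -/
def gap (p : PricingPolicy N) (u : Users N) (Y : ℝ) (d : ℕ → ℝ)
    (ε : ℕ → Fin N → Ω → ℝ) (P : Measure Ω) (t : ℕ) : ℝ :=
  (∫ ω, onlineCost p u Y d ε t ω ∂P) - ∫ ω, offlineCost u Y d ε t ω ∂P

/-- The regret over the first `T` periods. -/
def regret (p : PricingPolicy N) (u : Users N) (Y : ℝ) (d : ℕ → ℝ)
    (ε : ℕ → Fin N → Ω → ℝ) (P : Measure Ω) (T : ℕ) : ℝ :=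
  (∫ ω, ∑ t ∈ Finset.range T, onlineCost p u Y d ε t ω ∂P)
    - ∫ ω, ∑ t ∈ Finset.range T, offlineCost u Y d ε t ω ∂P

/-- The mean of the first `t` targets. -/
def targetMean (d : ℕ → ℝ) (t : ℕ) : ℝ :=
  (∑ s ∈ Finset.range t, d s) / t

/-- The empirical variance of the first `t` targets. -/
def targetVariance (d : ℕ → ℝ) (t : ℕ) : ℝ :=
  (∑ s ∈ Finset.range t, (d s - targetMean d t) ^ 2) / t

/-- The response of a user minimizes the user's net cost. -/
theorem Users.response_isMinOn (u : Users N) (l : ℝ) (i : Fin N) (hβ : 0 < u.β i) :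
    IsMinOn (fun x => u.userCost i x / N - l * x) Set.univ (u.response l i) := by
  have hN : (0 : ℝ) < N := by exact_mod_cast i.pos
  intro x _
  have key : (u.userCost i x / N - l * x)
      - (u.userCost i (u.response l i) / N - l * u.response l i)
      = u.β i / (2 * N) * (x - u.response l i) ^ 2 := by
    simp only [Users.userCost, Users.response]
    field_simp
    ring
  have : 0 ≤ u.β i / (2 * N) * (x - u.response l i) ^ 2 := by positivity
  simp only [Set.mem_ofPred_eq]
  linarith

/-- The response induced by the full-information price minimizes the expected cost of the
period over all (noiseless) responses `x`. -/
theorem Users.offlinePrice_isMinOn (hN : 0 < N) (u : Users N) (hβ : ∀ i, 0 < u.β i) (Y d : ℝ)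
    {P : Measure Ω} [IsProbabilityMeasure P] {ε : ℕ → Fin N → Ω → ℝ} {v : ℝ≥0}
    (hε : IsGaussianNoise ε v P) (t : ℕ) :
    IsMinOn (fun x : Fin N → ℝ => ∫ ω, u.cost Y d (fun i => x i + ε t i ω) ∂P) Set.univ
      (u.response (u.offlinePrice Y d)) := by
  have hN' : (0 : ℝ) < N := by exact_mod_cast hN
  have hL2 : ∀ i, MemLp (ε t i) 2 P := by
    intro i
    have h := memLp_id_gaussianReal (μ := 0) (v := v) 2
    rw [← hε.law t i] at h
    exact (memLp_map_measure_iff (g := id) aestronglyMeasurable_id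
      (hε.measurable t i).aemeasurable).1 (by simpa using h)
  have hmean : ∀ i, ∫ ω, ε t i ω ∂P = 0 := by
    intro i
    have h := integral_map (μ := P) (hε.measurable t i).aemeasurable (f := fun x : ℝ => x)
      (by fun_prop)
    rw [hε.law t i, integral_id_gaussianReal] at h
    exact h.symm
  have hx : ∀ (x : Fin N → ℝ) (i : Fin N), MemLp (fun ω => x i + ε t i ω) 2 P := fun x i =>
    (memLp_const (x i)).add (hL2 i)
  have hint : ∀ x : Fin N → ℝ, Integrable (fun ω => u.cost Y d (fun i => x i + ε t i ω)) P := by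
    intro x
    unfold Users.cost Users.userCost
    refine Integrable.add (integrable_finsetSum _ fun i _ => ?_) ?_
    · exact ((((hx x i).integrable_sq).const_mul _).add
        (((hx x i).integrable (by norm_num)).const_mul _)).const_mul _
    · refine Integrable.const_mul (MemLp.integrable_sq ?_) _
      exact (memLp_finsetSum _ fun i _ => hx x i).sub (memLp_const _)
  set l := u.offlinePrice Y d with hl
  set z := u.response l with hz
  -- the first-order condition
  have hfoc : ∀ i, u.β i * z i + u.α i + ((∑ j, z j) - Y * d) = 0 := by
    intro i
    have h1 : u.β i * z i + u.α i = N * l := by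
      have := (hβ i).ne'
      simp only [hz, Users.response]
      field_simp
      ring
    have h2 : ∑ j, z j = l * (∑ j, (N : ℝ) / u.β j) - ∑ j, u.α j / u.β j := by
      rw [Finset.mul_sum, ← Finset.sum_sub_distrib]
      refine Finset.sum_congr rfl fun j _ => ?_
      simp only [hz, Users.response]
      ring
    have hpos : (0 : ℝ) < N + ∑ j, (N : ℝ) / u.β j := by
      have : 0 ≤ ∑ j, (N : ℝ) / u.β j :=
        Finset.sum_nonneg fun j _ => div_nonneg hN'.le (hβ j).le
      linarith
    have h3 : l * (N + ∑ j, (N : ℝ) / u.β j) = Y * d + ∑ j, u.α j / u.β j := by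
      rw [hl, Users.offlinePrice, div_mul_cancel₀ _ hpos.ne']
    rw [h1, h2]
    linarith
  intro x _
  simp only [Set.mem_ofPred_eq]
  rw [← sub_nonneg, ← integral_sub (hint x) (hint z)]
  set c : Fin N → ℝ := fun i =>
    1 / (N : ℝ) * (u.β i * (x i - z i) + ((∑ j, x j) - ∑ j, z j)) with hc
  set q : ℝ := (∑ i, 1 / (2 * (N : ℝ)) * u.β i * (x i - z i) ^ 2)
    + 1 / (2 * (N : ℝ)) * ((∑ j, x j) - ∑ j, z j) ^ 2 with hq
  have hdiff : ∀ ω, u.cost Y d (fun i => x i + ε t i ω) - u.cost Y d (fun i => z i + ε t i ω)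
      = q + ∑ i, c i * ε t i ω := by
    intro ω
    have e1 : ∀ i, 1 / (N : ℝ) * u.userCost i (x i + ε t i ω)
        - 1 / (N : ℝ) * u.userCost i (z i + ε t i ω)
        = 1 / (2 * (N : ℝ)) * u.β i * (x i - z i) ^ 2
          + (1 / (N : ℝ) * (u.β i * (x i - z i))) * ε t i ω
          - 1 / (N : ℝ) * ((∑ j, z j) - Y * d) * (x i - z i) := by
      intro i
      have h := hfoc i
      have h' : u.α i = - u.β i * z i - ((∑ j, z j) - Y * d) := by linarith
      simp only [Users.userCost, h']
      field_simp
      ring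
    have e2 : ∑ i, c i * ε t i ω = (∑ i, (1 / (N : ℝ) * (u.β i * (x i - z i))) * ε t i ω)
        + 1 / (N : ℝ) * ((∑ j, x j) - ∑ j, z j) * ∑ i, ε t i ω := by
      rw [Finset.mul_sum, ← Finset.sum_add_distrib]
      refine Finset.sum_congr rfl fun i _ => ?_
      simp only [hc]
      ring
    have e3 : (∑ i, 1 / (N : ℝ) * u.userCost i (x i + ε t i ω))
        - (∑ i, 1 / (N : ℝ) * u.userCost i (z i + ε t i ω))
        = (∑ i, 1 / (2 * (N : ℝ)) * u.β i * (x i - z i) ^ 2)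
          + (∑ i, (1 / (N : ℝ) * (u.β i * (x i - z i))) * ε t i ω)
          - 1 / (N : ℝ) * ((∑ j, z j) - Y * d) * ((∑ j, x j) - ∑ j, z j) := by
      rw [← Finset.sum_sub_distrib, Finset.sum_congr rfl fun i _ => e1 i,
        Finset.sum_sub_distrib, Finset.sum_add_distrib, ← Finset.mul_sum,
        Finset.sum_sub_distrib]
    simp only [Users.cost, Finset.sum_add_distrib]
    rw [e2, hq]
    have hN2 : 1 / (2 * (N : ℝ)) = 1 / 2 * (1 / (N : ℝ)) := by field_simp
    rw [hN2] at e3 ⊢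
    linear_combination e3
  have hε1 : ∀ i, Integrable (ε t i) P := fun i => (hL2 i).integrable (by norm_num)
  have hval : ∫ ω, (u.cost Y d (fun i => x i + ε t i ω) - u.cost Y d (fun i => z i + ε t i ω)) ∂P
      = q := by
    simp only [hdiff]
    rw [integral_add (integrable_const _)
      (integrable_finsetSum _ fun i _ => (hε1 i).const_mul _),
      integral_finsetSum _ fun i _ => (hε1 i).const_mul _]
    simp [integral_const_mul, hmean]
  rw [hval, hq]
  have : 0 ≤ ∑ i, 1 / (2 * (N : ℝ)) * u.β i * (x i - z i) ^ 2 :=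
    Finset.sum_nonneg fun i _ => by have := (hβ i).le; positivity
  positivity

end DemandResponse

end

/-! The policy charges an affine function of the target. With γ = 1 + Σ 1/β_i, the observable
`costGradient` is γ times the current price error plus centred noise (`costGradient_response`). Let
φ_t = (1, d_t), let G_t be the regularized normal matrix, let e_t be the error of the two
coefficients, r_t = φ_t · e_t the price error and ξ_t the mean noise. A least squares step along the
gradient gives e_{t+1} = e_t - G_{t+1}⁻¹ φ_t (γ r_t + ξ_t), that is, recursive least squares with an
unknown relative gain γ ≥ 1 (`errorProcess_toLp`). The cost is quadratic and r_t is orthogonal to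
ξ_t in L², so the gap is a constant times E r_t² (`integrable_and_gap_eq`). It remains to show that
E r_t² has exact order 1/t. Only orthogonality of the noise in L² is used for this, and the spread
of the targets enters through det G_t ≥ c (t + 1)².

Upper bound. The energy V_t = E e_tᵀ G_t e_t satisfies an exact identity (`energy_succ`): it
dissipates a multiple of E r_t² and gains O(1/t) from the noise. Alone this only gives V_t = O(log
t). However G_t e_t changes by (1 - γ) φ_t r_t - φ_t ξ_t, so over a block from s to t it is
controlled by V_s, by the noise and by the residuals, which the dissipation bounds by V_s - V_t.
When t/s is a large constant, this yields a contraction up to a constant (`energy_block_le`), so V_t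
is bounded and E r_t² = O(1/t).

Lower bound. The adjoint recursion, run backwards from G_t⁻¹ φ_t, writes r_t as a vector orthogonal
to the later noise minus Σ y_j ξ_j (`adjoint_image_eq`), so E r_t² ≥ τ Σ y_j², where τ is the
variance of ξ. If Σ y_j² were small, the adjoint vector would hardly move, and then Σ y_j² would be
close to the form of G_t - G_s at G_t⁻¹ φ_t, which has order 1/t (`le_sum_sq`).

`exists_residual_bounds` combines both bounds with uniform constants; harmonic sums turn them into
logarithms. -/

namespace DemandResponse

noncomputable section

/-! ### Positive definite quadratic forms in two vectors of an inner product space -/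

section Gram

variable {E : Type*} [NormedAddCommGroup E] [InnerProductSpace ℝ E]

/-- The quadratic form with matrix `!![A, B; B, C]` evaluated at a pair of vectors. -/
def gramForm (A B C : ℝ) (a b : E) : ℝ :=
  A * ‖a‖ ^ 2 + 2 * B * inner ℝ a b + C * ‖b‖ ^ 2

theorem norm_sq_smul_add_smul (p q : ℝ) (a b : E) :
    ‖p • a + q • b‖ ^ 2 = p ^ 2 * ‖a‖ ^ 2 + 2 * (p * q) * inner ℝ a b + q ^ 2 * ‖b‖ ^ 2 := by
  rw [norm_add_sq_real, norm_smul, norm_smul, real_inner_smul_left, real_inner_smul_right,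
    mul_pow, mul_pow, Real.norm_eq_abs, Real.norm_eq_abs, sq_abs, sq_abs]
  ring

theorem gramForm_nonneg {A B C : ℝ} (hA : 0 < A) (h : B ^ 2 ≤ A * C) (a b : E) :
    0 ≤ gramForm A B C a b := by
  have h1 : A * gramForm A B C a b = ‖A • a + B • b‖ ^ 2 + (A * C - B ^ 2) * ‖b‖ ^ 2 := by
    rw [norm_sq_smul_add_smul, gramForm]; ring
  have h2 : 0 ≤ A * gramForm A B C a b := by
    rw [h1]
    have : 0 ≤ A * C - B ^ 2 := by linarith
    positivity
  exact nonneg_of_mul_nonneg_right h2 hA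

/-- Cayley–Hamilton for a symmetric 2×2 matrix: G² = (tr G) G - (det G) I, read as quadratic forms.
-/
theorem gramForm_image (A B C : ℝ) (a b : E) :
    ‖A • a + B • b‖ ^ 2 + ‖B • a + C • b‖ ^ 2
      = (A + C) * gramForm A B C a b - (A * C - B ^ 2) * (‖a‖ ^ 2 + ‖b‖ ^ 2) := by
  rw [norm_sq_smul_add_smul, norm_sq_smul_add_smul, gramForm]; ring

theorem det_mul_norm_le_gramForm (A B C : ℝ) (a b : E) :
    (A * C - B ^ 2) * (‖a‖ ^ 2 + ‖b‖ ^ 2) ≤ (A + C) * gramForm A B C a b := by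
  have h := gramForm_image A B C a b
  have : 0 ≤ ‖A • a + B • b‖ ^ 2 + ‖B • a + C • b‖ ^ 2 := by positivity
  linarith

/-- The difference (tr G) I - G is the adjugate of G, which is again positive semidefinite. -/
theorem gramForm_le_trace_mul {A B C : ℝ} (hC : 0 < C) (h : B ^ 2 ≤ A * C) (a b : E) :
    gramForm A B C a b ≤ (A + C) * (‖a‖ ^ 2 + ‖b‖ ^ 2) := by
  have h1 := gramForm_nonneg (A := C) (B := -B) (C := A) hC (by nlinarith) a b
  simp only [gramForm] at h1 ⊢
  linarith

/-- The difference of the two sides is the form of G at the image of the pair under G, by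
Cayley–Hamilton multiplied by G. Hence the form of G is bounded by tr G / det G times the squared
norm of the image. -/
theorem det_mul_gramForm_le {A B C : ℝ} (hA : 0 < A) (h : B ^ 2 ≤ A * C) (a b : E) :
    (A * C - B ^ 2) * gramForm A B C a b
      ≤ (A + C) * (‖A • a + B • b‖ ^ 2 + ‖B • a + C • b‖ ^ 2) := by
  have h1 := gramForm_nonneg hA h (A • a + B • b) (B • a + C • b)
  have h2 : inner ℝ (A • a + B • b) (B • a + C • b)
      = A * B * ‖a‖ ^ 2 + (A * C + B ^ 2) * inner ℝ a b + B * C * ‖b‖ ^ 2 := by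
    simp only [inner_add_left, inner_add_right, real_inner_smul_left, real_inner_smul_right,
      real_inner_self_eq_norm_sq, real_inner_comm a b]
    rw [real_inner_comm b a]
    ring
  have h3 : (A + C) * (‖A • a + B • b‖ ^ 2 + ‖B • a + C • b‖ ^ 2)
      - (A * C - B ^ 2) * gramForm A B C a b
      = gramForm A B C (A • a + B • b) (B • a + C • b) := by
    simp only [gramForm]
    rw [h2, norm_sq_smul_add_smul, norm_sq_smul_add_smul]
    ring
  linarith

theorem norm_sq_sum_le_mul_sum {F : Type*} [SeminormedAddCommGroup F] (s t : ℕ) (f : ℕ → F) :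
    ‖∑ j ∈ Finset.Ico s t, f j‖ ^ 2 ≤ ((t - s : ℕ) : ℝ) * ∑ j ∈ Finset.Ico s t, ‖f j‖ ^ 2 := by
  have h1 : ‖∑ j ∈ Finset.Ico s t, f j‖ ^ 2 ≤ (∑ j ∈ Finset.Ico s t, ‖f j‖) ^ 2 := by
    gcongr
    exact norm_sum_le _ _
  have h2 := sq_sum_le_card_mul_sum_sq (s := Finset.Ico s t) (f := fun j => ‖f j‖)
  rw [Nat.card_Ico] at h2
  exact h1.trans h2

theorem norm_sq_sum_of_orthogonal {ξ : ℕ → E} {τ : ℝ}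
    (hξ : ∀ s t, inner ℝ (ξ s) (ξ t) = if s = t then τ else 0) (S : Finset ℕ) (c : ℕ → ℝ) :
    ‖∑ j ∈ S, c j • ξ j‖ ^ 2 = τ * ∑ j ∈ S, c j ^ 2 := by
  rw [← real_inner_self_eq_norm_sq, sum_inner, Finset.mul_sum]
  refine Finset.sum_congr rfl fun i hi => ?_
  rw [inner_sum, Finset.sum_eq_single i]
  · rw [real_inner_smul_left, real_inner_smul_right, hξ, if_pos rfl]; ring
  · intro j _ hj
    rw [real_inner_smul_left, real_inner_smul_right, hξ, if_neg (Ne.symm hj)]; ring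
  · exact fun h => absurd hi h

end Gram

/-! ### The regularized normal matrix of the regressors `(1, x s)` -/

/-- The sum of the first `t` regressors. -/
def firstMoment (x : ℕ → ℝ) (t : ℕ) : ℝ := ∑ s ∈ Finset.range t, x s

/-- The regularized sum of squares of the first `t` regressors. -/
def secondMoment (x : ℕ → ℝ) (t : ℕ) : ℝ := 1 + ∑ s ∈ Finset.range t, x s ^ 2

/-- The determinant of the normal matrix
`!![t + 1, firstMoment x t; firstMoment x t, secondMoment x t]`. -/
def gramDet (x : ℕ → ℝ) (t : ℕ) : ℝ :=
  ((t : ℝ) + 1) * secondMoment x t - firstMoment x t ^ 2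

/-- The first coordinate of the inverse of the normal matrix at time `t` applied to `(1, z)`. -/
def gramInvFst (x : ℕ → ℝ) (t : ℕ) (z : ℝ) : ℝ :=
  (secondMoment x t - firstMoment x t * z) / gramDet x t

/-- The second coordinate of the inverse of the normal matrix at time `t` applied to `(1, z)`. -/
def gramInvSnd (x : ℕ → ℝ) (t : ℕ) (z : ℝ) : ℝ :=
  (((t : ℝ) + 1) * z - firstMoment x t) / gramDet x t

section Moments

variable (x : ℕ → ℝ)

theorem firstMoment_succ (t : ℕ) : firstMoment x (t + 1) = firstMoment x t + x t :=
  Finset.sum_range_succ _ _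

theorem secondMoment_succ (t : ℕ) : secondMoment x (t + 1) = secondMoment x t + x t ^ 2 := by
  rw [secondMoment, secondMoment, Finset.sum_range_succ, add_assoc]

theorem one_le_secondMoment (t : ℕ) : 1 ≤ secondMoment x t :=
  le_add_of_nonneg_right (Finset.sum_nonneg fun s _ => sq_nonneg (x s))

theorem gramDet_eq (t : ℕ) : gramDet x t = t + secondMoment x t
    + (t * ∑ s ∈ Finset.range t, x s ^ 2 - (∑ s ∈ Finset.range t, x s) ^ 2) := by
  simp only [gramDet, secondMoment, firstMoment]; ring

/-- Cauchy–Schwarz makes the unregularized determinant nonnegative; the regularization by the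
identity supplies the rest, so G is invertible from the start and without any excitation. -/
theorem add_one_le_gramDet (t : ℕ) : (t : ℝ) + 1 ≤ gramDet x t := by
  have h := sq_sum_le_card_mul_sum_sq (s := Finset.range t) (f := x)
  rw [Finset.card_range] at h
  have h2 := one_le_secondMoment x t
  rw [gramDet_eq]
  linarith

theorem gramDet_pos (t : ℕ) : 0 < gramDet x t :=
  lt_of_lt_of_le (by positivity) (add_one_le_gramDet x t)

theorem firstMoment_sq_le (t : ℕ) : firstMoment x t ^ 2 ≤ ((t : ℝ) + 1) * secondMoment x t := by
  have := gramDet_pos x t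
  rw [gramDet] at this
  linarith

theorem gramInv_fst_eq (t : ℕ) (z : ℝ) :
    ((t : ℝ) + 1) * gramInvFst x t z + firstMoment x t * gramInvSnd x t z = 1 := by
  have := (gramDet_pos x t).ne'
  rw [gramInvFst, gramInvSnd]
  field_simp
  rw [gramDet]; ring

theorem gramInv_snd_eq (t : ℕ) (z : ℝ) :
    firstMoment x t * gramInvFst x t z + secondMoment x t * gramInvSnd x t z = z := by
  have := (gramDet_pos x t).ne'
  rw [gramInvFst, gramInvSnd]
  field_simp
  rw [gramDet]; ring

theorem trace_le {X : ℝ} (hx : ∀ t, |x t| ≤ X) (t : ℕ) :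
    ((t : ℝ) + 1) + secondMoment x t ≤ (2 + X ^ 2) * ((t : ℝ) + 1) := by
  have h1 : ∑ s ∈ Finset.range t, x s ^ 2 ≤ ∑ s ∈ Finset.range t, X ^ 2 :=
    Finset.sum_le_sum fun s _ => sq_le_sq' (abs_le.1 (hx s)).1 (abs_le.1 (hx s)).2
  rw [Finset.sum_const, Finset.card_range, nsmul_eq_mul] at h1
  rw [secondMoment]
  nlinarith [sq_nonneg X, (Nat.cast_nonneg t : (0 : ℝ) ≤ t)]

/-- The ratio of the trace to the determinant of the normal matrix, which bounds the norm of
its inverse. -/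
def gramRatio (t : ℕ) : ℝ := (((t : ℝ) + 1) + secondMoment x t) / gramDet x t

theorem gramRatio_nonneg (t : ℕ) : 0 ≤ gramRatio x t := by
  have h1 := gramDet_pos x t
  have h2 := one_le_secondMoment x t
  rw [gramRatio]
  positivity

theorem gramRatio_le {X : ℝ} (hx : ∀ t, |x t| ≤ X) (t : ℕ) : gramRatio x t ≤ 2 + X ^ 2 := by
  rw [gramRatio, div_le_iff₀ (gramDet_pos x t)]
  refine (trace_le x hx t).trans ?_
  gcongr
  exact add_one_le_gramDet x t

theorem gramRatio_le_div {X c : ℝ} (hx : ∀ t, |x t| ≤ X) (hc : 0 < c) {t : ℕ}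
    (hdet : c * ((t : ℝ) + 1) ^ 2 ≤ gramDet x t) :
    gramRatio x t ≤ (2 + X ^ 2) / c / ((t : ℝ) + 1) := by
  have ht : (0 : ℝ) < (t : ℝ) + 1 := by positivity
  rw [gramRatio, div_le_iff₀ (gramDet_pos x t)]
  refine (trace_le x hx t).trans ?_
  have h2 : (2 + X ^ 2) * ((t : ℝ) + 1)
      = (2 + X ^ 2) / c / ((t : ℝ) + 1) * (c * ((t : ℝ) + 1) ^ 2) := by
    field_simp
  rw [h2]
  gcongr

variable {E : Type*} [NormedAddCommGroup E] [InnerProductSpace ℝ E]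

theorem norm_sq_le_gramRatio_mul (t : ℕ) (a b : E) :
    ‖a‖ ^ 2 + ‖b‖ ^ 2
      ≤ gramRatio x t * gramForm ((t : ℝ) + 1) (firstMoment x t) (secondMoment x t) a b := by
  rw [gramRatio, div_mul_eq_mul_div, le_div_iff₀ (gramDet_pos x t), mul_comm]
  exact det_mul_norm_le_gramForm _ _ _ a b

theorem gramForm_le_gramRatio_mul (t : ℕ) (a b : E) :
    gramForm ((t : ℝ) + 1) (firstMoment x t) (secondMoment x t) a b
      ≤ gramRatio x t * (‖((t : ℝ) + 1) • a + firstMoment x t • b‖ ^ 2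
        + ‖firstMoment x t • a + secondMoment x t • b‖ ^ 2) := by
  rw [gramRatio, div_mul_eq_mul_div, le_div_iff₀ (gramDet_pos x t), mul_comm]
  exact det_mul_gramForm_le (by positivity) (firstMoment_sq_le x t) a b

theorem norm_sq_add_smul_le (z : ℝ) (a b : E) :
    ‖a + z • b‖ ^ 2 ≤ (1 + z ^ 2) * (‖a‖ ^ 2 + ‖b‖ ^ 2) := by
  have h1 := norm_sq_smul_add_smul 1 z a b
  have h2 := norm_sq_smul_add_smul z (-1) a b
  rw [one_smul] at h1
  have h3 := sq_nonneg ‖z • a + (-1 : ℝ) • b‖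
  nlinarith

end Moments

section Leverage

variable {E : Type*} [NormedAddCommGroup E] [InnerProductSpace ℝ E]

/-- The terms are grouped by the image of (p, q) under the matrix: when (p, q) = G⁻¹ φ, these groups
collapse to the coordinates of φ. -/
theorem gramForm_sub_smul (A B C p q : ℝ) (a b k : E) :
    gramForm A B C (a - p • k) (b - q • k) = gramForm A B C a b
      - 2 * ((A * p + B * q) * inner ℝ a k + (B * p + C * q) * inner ℝ b k)
      + (p * (A * p + B * q) + q * (B * p + C * q)) * ‖k‖ ^ 2 := by
  simp only [gramForm, norm_sub_sq_real, norm_smul, mul_pow, Real.norm_eq_abs, sq_abs,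
    inner_sub_left, inner_sub_right, real_inner_smul_left, real_inner_smul_right,
    real_inner_self_eq_norm_sq]
  rw [real_inner_comm b k]
  ring

theorem gramForm_add_rank_one (A B C z : ℝ) (a b : E) :
    gramForm (A + 1) (B + z) (C + z ^ 2) a b = gramForm A B C a b + ‖a + z • b‖ ^ 2 := by
  have h1 := norm_sq_smul_add_smul 1 z a b
  rw [one_smul] at h1
  rw [h1, gramForm, gramForm]; ring

variable (x : ℕ → ℝ)

/-- The leverage `φᵀ G⁻¹ φ` of the regressor `φ = (1, z)`, where `G` is the normal matrix at
time `t`. -/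
def leverage (t : ℕ) (z : ℝ) : ℝ := gramInvFst x t z + z * gramInvSnd x t z

/-- This is φᵀ G⁻¹ φ = (G⁻¹ φ)ᵀ G (G⁻¹ φ), which makes positivity and the trace/determinant bounds
available. -/
theorem leverage_eq_gramForm (t : ℕ) (z : ℝ) :
    leverage x t z = gramForm ((t : ℝ) + 1) (firstMoment x t) (secondMoment x t)
      (gramInvFst x t z) (gramInvSnd x t z) := by
  have h1 := gramInv_fst_eq x t z
  have h2 := gramInv_snd_eq x t z
  simp only [leverage, gramForm, Real.norm_eq_abs, sq_abs, inner]
  simp only [RCLike.re_to_real]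
  linear_combination -(gramInvFst x t z) * h1 - (gramInvSnd x t z) * h2

theorem leverage_nonneg (t : ℕ) (z : ℝ) : 0 ≤ leverage x t z := by
  rw [leverage_eq_gramForm]
  exact gramForm_nonneg (by positivity) (firstMoment_sq_le x t) _ _

theorem leverage_le (t : ℕ) (z : ℝ) : leverage x t z ≤ gramRatio x t * (1 + z ^ 2) := by
  rw [leverage_eq_gramForm]
  refine (gramForm_le_gramRatio_mul x t _ _).trans (le_of_eq ?_)
  have h1 := gramInv_fst_eq x t z
  have h2 := gramInv_snd_eq x t z
  rw [smul_eq_mul, smul_eq_mul, smul_eq_mul, smul_eq_mul, h1, h2]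
  simp

theorem gramInv_sq_le (t : ℕ) (z : ℝ) :
    gramInvFst x t z ^ 2 + gramInvSnd x t z ^ 2 ≤ gramRatio x t ^ 2 * (1 + z ^ 2) := by
  have h := norm_sq_le_gramRatio_mul x t (gramInvFst x t z) (gramInvSnd x t z)
  rw [← leverage_eq_gramForm] at h
  simp only [Real.norm_eq_abs, sq_abs] at h
  have h2 := mul_le_mul_of_nonneg_left (leverage_le x t z) (gramRatio_nonneg x t)
  linarith

end Leverage

/-! ### Dynamics and energy of the estimation errors -/

theorem norm_sq_add_three_le {E : Type*} [SeminormedAddCommGroup E] (u v w : E) :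
    ‖u + v + w‖ ^ 2 ≤ 3 * (‖u‖ ^ 2 + ‖v‖ ^ 2 + ‖w‖ ^ 2) := by
  have h1 : ‖u + v + w‖ ≤ ‖u‖ + ‖v‖ + ‖w‖ := norm_add₃_le
  have h2 : ‖u + v + w‖ ^ 2 ≤ (‖u‖ + ‖v‖ + ‖w‖) ^ 2 := by gcongr
  nlinarith [sq_nonneg (‖u‖ - ‖v‖), sq_nonneg (‖u‖ - ‖w‖), sq_nonneg (‖v‖ - ‖w‖)]

/-- The dynamics of the estimation errors `a t`, `b t` of intercept and slope, as vectors of an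
inner product space: a recursive least squares step with relative gain `γ`, driven by
orthogonal noise `ξ` with variance `τ`. -/
structure ErrorProcess {E : Type*} [NormedAddCommGroup E] [InnerProductSpace ℝ E]
    (x : ℕ → ℝ) (γ τ : ℝ) (a b ξ : ℕ → E) : Prop where
  fst_succ : ∀ t, a (t + 1)
    = a t - gramInvFst x (t + 1) (x t) • (γ • (a t + x t • b t) + ξ t)
  snd_succ : ∀ t, b (t + 1)
    = b t - gramInvSnd x (t + 1) (x t) • (γ • (a t + x t • b t) + ξ t)
  noise : ∀ s t, inner ℝ (ξ s) (ξ t) = if s = t then τ else 0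
  fst_zero : ∀ t, inner ℝ (a 0) (ξ t) = 0
  snd_zero : ∀ t, inner ℝ (b 0) (ξ t) = 0

/-- The regressors are bounded, and the determinant of the normal matrix grows
quadratically. -/
structure IsExcited (x : ℕ → ℝ) (X c : ℝ) (t₀ : ℕ) : Prop where
  bound : ∀ t, |x t| ≤ X
  le_det : ∀ t, t₀ ≤ t → c * ((t : ℝ) + 1) ^ 2 ≤ gramDet x t

theorem IsExcited.sq_le {x : ℕ → ℝ} {X c : ℝ} {t₀ : ℕ} (h : IsExcited x X c t₀) (t : ℕ) :
    x t ^ 2 ≤ X ^ 2 :=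
  sq_le_sq' (abs_le.1 (h.bound t)).1 (abs_le.1 (h.bound t)).2

theorem IsExcited.one_add_sq_le {x : ℕ → ℝ} {X c : ℝ} {t₀ : ℕ} (h : IsExcited x X c t₀) (t : ℕ) :
    1 + x t ^ 2 ≤ 2 + X ^ 2 := by
  linarith [h.sq_le t]

namespace ErrorProcess

variable {E : Type*} [NormedAddCommGroup E] [InnerProductSpace ℝ E]
  {x : ℕ → ℝ} {γ τ : ℝ} {a b ξ : ℕ → E}

/-- The errors at time t are built from the initial errors and the noise of strictly earlier periods
only. -/
theorem inner_noise (h : ErrorProcess x γ τ a b ξ) (t : ℕ) :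
    ∀ s, t ≤ s → inner ℝ (a t) (ξ s) = 0 ∧ inner ℝ (b t) (ξ s) = 0 := by
  induction t with
  | zero => exact fun s _ => ⟨h.fst_zero s, h.snd_zero s⟩
  | succ t ih =>
    intro s hs
    obtain ⟨h1, h2⟩ := ih s (by omega)
    have h3 := h.noise t s
    rw [if_neg (by omega)] at h3
    rw [h.fst_succ, h.snd_succ]
    simp [inner_sub_left, inner_add_left, real_inner_smul_left, h1, h2, h3]

theorem inner_residual_noise (h : ErrorProcess x γ τ a b ξ) {s t : ℕ} (hst : t ≤ s) :
    inner ℝ (a t + x t • b t) (ξ s) = 0 := by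
  obtain ⟨h1, h2⟩ := h.inner_noise t s hst
  rw [inner_add_left, real_inner_smul_left, h1, h2]; ring

/-- The energy of the estimation error: its quadratic form in the normal matrix. -/
def energy (x : ℕ → ℝ) (a b : ℕ → E) (t : ℕ) : ℝ :=
  gramForm ((t : ℝ) + 1) (firstMoment x t) (secondMoment x t) (a t) (b t)

theorem energy_nonneg (x : ℕ → ℝ) (a b : ℕ → E) (t : ℕ) : 0 ≤ energy x a b t :=
  gramForm_nonneg (by positivity) (firstMoment_sq_le x t) _ _

/-- The gain uses the matrix of time t + 1, so the cross term sees φ rather than G⁻¹ φ, and the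
rank-one growth of the matrix adds one more squared residual. This explains the coefficient 1 - 2γ,
which is at most -1 for γ ≥ 1. -/
theorem energy_succ (h : ErrorProcess x γ τ a b ξ) (t : ℕ) :
    energy x a b (t + 1) = energy x a b t
      + (1 - 2 * γ + γ ^ 2 * leverage x (t + 1) (x t)) * ‖a t + x t • b t‖ ^ 2
      + leverage x (t + 1) (x t) * τ := by
  have h1 := gramInv_fst_eq x (t + 1) (x t)
  have h2 := gramInv_snd_eq x (t + 1) (x t)
  have hτ := h.noise t t
  rw [if_pos rfl, real_inner_self_eq_norm_sq] at hτ
  have horth := h.inner_residual_noise (le_refl t)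
  rw [energy, h.fst_succ, h.snd_succ, gramForm_sub_smul, h1, h2, firstMoment_succ,
    secondMoment_succ, Nat.cast_succ, gramForm_add_rank_one, ← energy]
  set k := γ • (a t + x t • b t) + ξ t with hk
  have e1 : 1 * inner ℝ (a t) k + x t * inner ℝ (b t) k = γ * ‖a t + x t • b t‖ ^ 2 := by
    have e : 1 * inner ℝ (a t) k + x t * inner ℝ (b t) k = inner ℝ (a t + x t • b t) k := by
      rw [inner_add_left, real_inner_smul_left]; ring
    rw [e, hk, inner_add_right, real_inner_smul_right, horth, real_inner_self_eq_norm_sq]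
    ring
  have e2 : ‖k‖ ^ 2 = γ ^ 2 * ‖a t + x t • b t‖ ^ 2 + τ := by
    rw [hk, norm_add_sq_real, norm_smul, real_inner_smul_left, horth, hτ, mul_pow,
      Real.norm_eq_abs, sq_abs]
    ring
  rw [e1, e2, leverage]
  ring

/-- One step of the dynamics for the normal matrix applied to the error. -/
theorem image_succ (h : ErrorProcess x γ τ a b ξ) (t : ℕ) :
    ((t + 1 : ℕ) + 1 : ℝ) • a (t + 1) + firstMoment x (t + 1) • b (t + 1)
      = ((t : ℝ) + 1) • a t + firstMoment x t • b t + (1 - γ) • (a t + x t • b t) - ξ t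
    ∧ firstMoment x (t + 1) • a (t + 1) + secondMoment x (t + 1) • b (t + 1)
      = firstMoment x t • a t + secondMoment x t • b t
        + x t • ((1 - γ) • (a t + x t • b t) - ξ t) := by
  have h1 := gramInv_fst_eq x (t + 1) (x t)
  have h2 := gramInv_snd_eq x (t + 1) (x t)
  have e1 : ∀ (p q α β : ℝ) (u w k : E), α • (u - p • k) + β • (w - q • k)
      = α • u + β • w - (α * p + β * q) • k := fun p q α β u w k => by module
  rw [h.fst_succ, h.snd_succ, e1, e1, h1, h2, firstMoment_succ, secondMoment_succ,
    Nat.cast_succ]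
  constructor <;> module

/-- Unlike the error itself, its image under the normal matrix has increments with no inverse matrix
in them, so the one-step relation telescopes. -/
theorem image_eq (h : ErrorProcess x γ τ a b ξ) {s t : ℕ} (hst : s ≤ t) :
    ((t : ℝ) + 1) • a t + firstMoment x t • b t
      = ((s : ℝ) + 1) • a s + firstMoment x s • b s
        + (1 - γ) • (∑ j ∈ Finset.Ico s t, (a j + x j • b j))
        + (-1 : ℝ) • ∑ j ∈ Finset.Ico s t, (1 : ℝ) • ξ j
    ∧ firstMoment x t • a t + secondMoment x t • b t
      = firstMoment x s • a s + secondMoment x s • b s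
        + (1 - γ) • (∑ j ∈ Finset.Ico s t, x j • (a j + x j • b j))
        + (-1 : ℝ) • ∑ j ∈ Finset.Ico s t, x j • ξ j := by
  induction t, hst using Nat.le_induction with
  | base => simp
  | succ t hst ih =>
    obtain ⟨h1, h2⟩ := h.image_succ t
    rw [h1, h2, ih.1, ih.2]
    simp only [Finset.sum_Ico_succ_top hst]
    constructor <;> module

variable {X c Γ : ℝ} {t₀ : ℕ}

/-- The normal matrix applied to the error, in terms of an earlier error and the residuals in
between. -/
theorem image_norm_sq_le (h : ErrorProcess x γ τ a b ξ) (hx : IsExcited x X c t₀)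
    (hγ : 1 ≤ γ) (hΓ : γ ≤ Γ) (hτ : 0 ≤ τ) {s t : ℕ} (hst : s ≤ t) :
    ‖((t : ℝ) + 1) • a t + firstMoment x t • b t‖ ^ 2
        + ‖firstMoment x t • a t + secondMoment x t • b t‖ ^ 2
      ≤ 3 * ((2 + X ^ 2) * (((s : ℝ) + 1) * energy x a b s + ((t - s : ℕ) : ℝ)
        * (Γ ^ 2 * ∑ j ∈ Finset.Ico s t, ‖a j + x j • b j‖ ^ 2 + τ))) := by
  obtain ⟨h1, h2⟩ := h.image_eq hst
  have h3 := norm_sq_add_three_le (((s : ℝ) + 1) • a s + firstMoment x s • b s)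
    ((1 - γ) • (∑ j ∈ Finset.Ico s t, (a j + x j • b j)))
    ((-1 : ℝ) • ∑ j ∈ Finset.Ico s t, (1 : ℝ) • ξ j)
  have h4 := norm_sq_add_three_le (firstMoment x s • a s + secondMoment x s • b s)
    ((1 - γ) • (∑ j ∈ Finset.Ico s t, x j • (a j + x j • b j)))
    ((-1 : ℝ) • ∑ j ∈ Finset.Ico s t, x j • ξ j)
  rw [← h1] at h3
  rw [← h2] at h4
  have hneg : ∀ v : E, ‖(-1 : ℝ) • v‖ ^ 2 = ‖v‖ ^ 2 := fun v => by simp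
  have hsm : ∀ v : E, ‖(1 - γ) • v‖ ^ 2 = (1 - γ) ^ 2 * ‖v‖ ^ 2 := fun v => by
    rw [norm_smul, mul_pow, Real.norm_eq_abs, sq_abs]
  rw [hneg, norm_sq_sum_of_orthogonal h.noise, hsm] at h3 h4
  have h5 := norm_sq_sum_le_mul_sum s t (fun j => a j + x j • b j)
  have h6 := norm_sq_sum_le_mul_sum s t (fun j => x j • (a j + x j • b j))
  simp only [one_pow, Finset.sum_const, Nat.card_Ico, nsmul_eq_mul, mul_one] at h3
  set n : ℝ := ((t - s : ℕ) : ℝ) with hn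
  have hn0 : 0 ≤ n := Nat.cast_nonneg _
  set R := ∑ j ∈ Finset.Ico s t, ‖a j + x j • b j‖ ^ 2 with hR
  have hR0 : 0 ≤ R := Finset.sum_nonneg fun j _ => sq_nonneg _
  have h7 : ∑ j ∈ Finset.Ico s t, ‖x j • (a j + x j • b j)‖ ^ 2 ≤ X ^ 2 * R := by
    rw [hR, Finset.mul_sum]
    refine Finset.sum_le_sum fun j _ => ?_
    rw [norm_smul, mul_pow, Real.norm_eq_abs, sq_abs]
    exact mul_le_mul_of_nonneg_right (hx.sq_le j) (sq_nonneg _)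
  have h8 : ∑ j ∈ Finset.Ico s t, x j ^ 2 ≤ n * X ^ 2 := by
    refine (Finset.sum_le_sum fun j _ => hx.sq_le j).trans (le_of_eq ?_)
    rw [Finset.sum_const, Nat.card_Ico, nsmul_eq_mul]
  have h9 : ‖∑ j ∈ Finset.Ico s t, x j • (a j + x j • b j)‖ ^ 2 ≤ n * (X ^ 2 * R) :=
    h6.trans (by gcongr)
  have h10 : (1 - γ) ^ 2 ≤ Γ ^ 2 := by nlinarith
  have h11 : (1 - γ) ^ 2 * ‖∑ j ∈ Finset.Ico s t, (a j + x j • b j)‖ ^ 2 ≤ Γ ^ 2 * (n * R) := by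
    gcongr
  have h12 : (1 - γ) ^ 2 * ‖∑ j ∈ Finset.Ico s t, x j • (a j + x j • b j)‖ ^ 2
      ≤ Γ ^ 2 * (n * (X ^ 2 * R)) := by
    gcongr
  have h13 : τ * ∑ j ∈ Finset.Ico s t, x j ^ 2 ≤ τ * (n * X ^ 2) := by gcongr
  -- The squared norm of the image at time s is at most the trace times the energy, since the
  -- determinant term has a favourable sign.
  have h14 := gramForm_image ((s : ℝ) + 1) (firstMoment x s) (secondMoment x s) (a s) (b s)
  rw [← energy] at h14
  have h15 : 0 ≤ (((s : ℝ) + 1) * secondMoment x s - firstMoment x s ^ 2)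
      * (‖a s‖ ^ 2 + ‖b s‖ ^ 2) :=
    mul_nonneg (by linarith [firstMoment_sq_le x s]) (by positivity)
  have h16 : (((s : ℝ) + 1) + secondMoment x s) * energy x a b s
      ≤ (2 + X ^ 2) * ((s : ℝ) + 1) * energy x a b s :=
    mul_le_mul_of_nonneg_right (trace_le x hx.bound s) (energy_nonneg _ _ _ _)
  have h17 : 0 ≤ Γ ^ 2 * (n * R) + n * τ := by positivity
  nlinarith

theorem residual_sq_le (hx : IsExcited x X c t₀) (t : ℕ) :
    ‖a t + x t • b t‖ ^ 2 ≤ (2 + X ^ 2) * (gramRatio x t * energy x a b t) := by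
  refine (norm_sq_add_smul_le (x t) (a t) (b t)).trans ?_
  have h1 := hx.one_add_sq_le t
  have h2 := norm_sq_le_gramRatio_mul x t (a t) (b t)
  gcongr
  exact h2

theorem leverage_le_of_isExcited (hx : IsExcited x X c t₀) (hc : 0 < c) {t : ℕ} (ht : t₀ ≤ t) :
    leverage x (t + 1) (x t) ≤ (2 + X ^ 2) ^ 2 / c / ((t : ℝ) + 1) := by
  have h1 := gramRatio_le_div x hx.bound hc (hx.le_det (t + 1) (by omega))
  have h2 := hx.one_add_sq_le t
  calc leverage x (t + 1) (x t) ≤ gramRatio x (t + 1) * (1 + x t ^ 2) := leverage_le _ _ _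
    _ ≤ (2 + X ^ 2) / c / (((t + 1 : ℕ) : ℝ) + 1) * (2 + X ^ 2) := by gcongr
    _ ≤ (2 + X ^ 2) / c / ((t : ℝ) + 1) * (2 + X ^ 2) := by
      gcongr
      simp
    _ = _ := by ring

/-- A crude bound for the growth of the energy in one step. -/
theorem energy_succ_le (h : ErrorProcess x γ τ a b ξ) (hx : IsExcited x X c t₀)
    (hγ : 1 ≤ γ) (hΓ : γ ≤ Γ) (hτ : 0 ≤ τ) (t : ℕ) :
    energy x a b (t + 1) ≤ (1 + Γ ^ 2 * (2 + X ^ 2) ^ 4) * energy x a b t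
      + (2 + X ^ 2) ^ 2 * τ := by
  have h1 := leverage_nonneg x (t + 1) (x t)
  have h2 : leverage x (t + 1) (x t) ≤ (2 + X ^ 2) ^ 2 := by
    refine (leverage_le x (t + 1) (x t)).trans ?_
    rw [sq (2 + X ^ 2)]
    exact mul_le_mul (gramRatio_le x hx.bound _) (hx.one_add_sq_le t) (by positivity)
      (by positivity)
  have h3 : ‖a t + x t • b t‖ ^ 2 ≤ (2 + X ^ 2) ^ 2 * energy x a b t := by
    refine (residual_sq_le hx t).trans ?_
    have := mul_le_mul_of_nonneg_right (gramRatio_le x hx.bound t) (energy_nonneg x a b t)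
    have := mul_le_mul_of_nonneg_left this (show 0 ≤ 2 + X ^ 2 by positivity)
    linarith
  have h4 : γ ^ 2 * leverage x (t + 1) (x t) * ‖a t + x t • b t‖ ^ 2
      ≤ Γ ^ 2 * (2 + X ^ 2) ^ 2 * ((2 + X ^ 2) ^ 2 * energy x a b t) := by
    gcongr
  have h5 : leverage x (t + 1) (x t) * τ ≤ (2 + X ^ 2) ^ 2 * τ := by gcongr
  rw [h.energy_succ]
  nlinarith [sq_nonneg ‖a t + x t • b t‖]

/-- The energy decreases at the rate of the squared residuals, up to a logarithmic term. -/
theorem energy_add_residuals_le (h : ErrorProcess x γ τ a b ξ) (hx : IsExcited x X c t₀)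
    (hc : 0 < c) (hγ : 1 ≤ γ) (hΓ : γ ≤ Γ) (hτ : 0 ≤ τ) {s t : ℕ} (hs : t₀ ≤ s)
    (hs' : 2 * (Γ ^ 2 * ((2 + X ^ 2) ^ 2 / c)) ≤ (s : ℝ) + 1) (hst : s ≤ t) :
    energy x a b t + 1 / 2 * ∑ j ∈ Finset.Ico s t, ‖a j + x j • b j‖ ^ 2
      ≤ energy x a b s + (2 + X ^ 2) ^ 2 / c * τ * (((t : ℝ) - s) / ((s : ℝ) + 1)) := by
  have hs0 : (0 : ℝ) < (s : ℝ) + 1 := by positivity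
  induction t, hst using Nat.le_induction with
  | base => simp
  | succ t hst ih =>
    have h1 := leverage_nonneg x (t + 1) (x t)
    have hst' : (s : ℝ) ≤ t := by exact_mod_cast hst
    have h2 : leverage x (t + 1) (x t) ≤ (2 + X ^ 2) ^ 2 / c / ((s : ℝ) + 1) :=
      (leverage_le_of_isExcited hx hc (hs.trans hst)).trans (by gcongr)
    -- Since s is large by `hs'`, the quadratic term costs at most 1/2, and 1 - 2γ + 1/2 ≤ -1/2.
    have h3 : γ ^ 2 * leverage x (t + 1) (x t) ≤ 1 / 2 := by
      calc γ ^ 2 * leverage x (t + 1) (x t)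
          ≤ Γ ^ 2 * ((2 + X ^ 2) ^ 2 / c / ((s : ℝ) + 1)) := by gcongr
        _ = (Γ ^ 2 * ((2 + X ^ 2) ^ 2 / c)) / ((s : ℝ) + 1) := by ring
        _ ≤ 1 / 2 := by rw [div_le_iff₀ hs0]; linarith
    have h4 : (1 - 2 * γ + γ ^ 2 * leverage x (t + 1) (x t)) * ‖a t + x t • b t‖ ^ 2
        ≤ -(1 / 2) * ‖a t + x t • b t‖ ^ 2 :=
      mul_le_mul_of_nonneg_right (by linarith) (sq_nonneg _)
    have h5 := mul_le_mul_of_nonneg_right h2 hτ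
    have h6 : (2 + X ^ 2) ^ 2 / c * τ * ((((t + 1 : ℕ) : ℝ) - s) / ((s : ℝ) + 1))
        = (2 + X ^ 2) ^ 2 / c * τ * (((t : ℝ) - s) / ((s : ℝ) + 1))
          + (2 + X ^ 2) ^ 2 / c / ((s : ℝ) + 1) * τ := by
      push_cast; ring
    rw [h6, Finset.sum_Ico_succ_top hst, h.energy_succ]
    linarith

/-- Contraction of the energy over a long block of periods. -/
theorem energy_block_le (h : ErrorProcess x γ τ a b ξ) (hx : IsExcited x X c t₀)
    (hc : 0 < c) (hγ : 1 ≤ γ) (hΓ : γ ≤ Γ) (hτ : 0 ≤ τ) {s t : ℕ} (hs : t₀ ≤ s)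
    (hs' : 2 * (Γ ^ 2 * ((2 + X ^ 2) ^ 2 / c)) ≤ (s : ℝ) + 1) (hst : s ≤ t)
    {H : ℝ} (hH : H = (2 + X ^ 2) ^ 2 / c) :
    (1 + 6 * H * Γ ^ 2) * energy x a b t
      ≤ (3 * H * (((s : ℝ) + 1) / ((t : ℝ) + 1)) + 6 * H * Γ ^ 2) * energy x a b s
        + 3 * H * τ + 6 * H * Γ ^ 2 * (H * τ * (((t : ℝ) - s) / ((s : ℝ) + 1))) := by
  have h1 := h.energy_add_residuals_le hx hc hγ hΓ hτ hs hs' hst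
  have h2 := h.image_norm_sq_le hx hγ hΓ hτ hst
  have h3 := gramForm_le_gramRatio_mul x t (a t) (b t)
  have h4 := gramRatio_le_div x hx.bound hc (hx.le_det t (hs.trans hst))
  rw [← energy] at h3
  rw [← hH] at h1
  set R := ∑ j ∈ Finset.Ico s t, ‖a j + x j • b j‖ ^ 2 with hR
  have hR0 : 0 ≤ R := Finset.sum_nonneg fun j _ => sq_nonneg _
  have ht0 : (0 : ℝ) < (t : ℝ) + 1 := by positivity
  have hH0 : 0 < H := by rw [hH]; positivity
  have hU0 := energy_nonneg x a b s
  have hn : ((t - s : ℕ) : ℝ) ≤ (t : ℝ) + 1 := by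
    have : ((t - s : ℕ) : ℝ) ≤ t := by exact_mod_cast Nat.sub_le t s
    linarith
  have h5 : energy x a b t ≤ (2 + X ^ 2) / c / ((t : ℝ) + 1)
      * (3 * ((2 + X ^ 2) * (((s : ℝ) + 1) * energy x a b s + ((t : ℝ) + 1)
        * (Γ ^ 2 * R + τ)))) := by
    refine h3.trans ((mul_le_mul_of_nonneg_left h2 (gramRatio_nonneg x t)).trans ?_)
    gcongr
  have h6 : (2 + X ^ 2) / c / ((t : ℝ) + 1)
      * (3 * ((2 + X ^ 2) * (((s : ℝ) + 1) * energy x a b s + ((t : ℝ) + 1)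
        * (Γ ^ 2 * R + τ))))
      = 3 * H * (((s : ℝ) + 1) / ((t : ℝ) + 1)) * energy x a b s
        + 3 * H * (Γ ^ 2 * R + τ) := by
    rw [hH]; field_simp
  rw [h6] at h5
  -- The weight 6HΓ² turns half the residual sum of `h1` into the 3HΓ²R of `h5`, so the residuals
  -- cancel on addition.
  have h7 := mul_le_mul_of_nonneg_left h1 (show 0 ≤ 6 * H * Γ ^ 2 by positivity)
  linarith

end ErrorProcess

/-- A sequence which grows at most geometrically and contracts over long blocks is bounded,
uniformly in the sequence. -/
theorem exists_bound_of_block_contraction (M F F' P Q H : ℝ) (t₁ : ℕ) (hM : 0 ≤ M)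
    (hF : 1 ≤ F) (hF' : 0 ≤ F') (hP : 0 ≤ P) (hQ : 0 ≤ Q) (hH : 0 ≤ H) :
    ∃ K : ℝ, 0 < K ∧ ∀ U : ℕ → ℝ, (∀ t, 0 ≤ U t) → U 0 ≤ M →
      (∀ t, U (t + 1) ≤ F * U t + F') →
      (∀ s t : ℕ, t₁ ≤ s → s ≤ t →
        (1 + P) * U t ≤ (H * (((s : ℝ) + 1) / ((t : ℝ) + 1)) + P) * U s
          + Q * (1 + ((t : ℝ) - s) / ((s : ℝ) + 1))) →
      ∀ t, U t ≤ K := by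
  -- The block ratio q makes the factor H (s+1)/(t+1) at most 1/2, which is strictly less than the 1
  -- on the left.
  obtain ⟨q, hq⟩ := exists_nat_ge (2 * H + 2)
  have hq1 : 1 ≤ q := by
    have : (1 : ℝ) ≤ q := by linarith
    exact_mod_cast this
  -- The crude geometric majorant covers the finitely many early times before a block can start
  -- beyond t₁.
  set f : ℕ → ℝ := fun t => Nat.rec M (fun _ y => F * y + F') t with hf
  have hfs : ∀ t, f (t + 1) = F * f t + F' := fun t => rfl
  have hf0 : ∀ t, 0 ≤ f t := by
    intro t
    induction t with
    | zero => exact hM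
    | succ t ih => rw [hfs]; positivity
  have hfm : Monotone f := monotone_nat_of_le_succ fun t => by
    rw [hfs]; nlinarith [hf0 t]
  refine ⟨f (q * (t₁ + 1)) + 2 * (Q * (1 + 2 * q)) + 1, by have := hf0 (q * (t₁ + 1)); positivity,
    fun U hU hU0 hU1 hU2 t => ?_⟩
  have hUf : ∀ t, U t ≤ f t := by
    intro t
    induction t with
    | zero => exact hU0
    | succ t ih =>
      rw [hfs]
      exact (hU1 t).trans (by gcongr)
  induction t using Nat.strong_induction_on with
  | _ t ih =>
    by_cases ht : t < q * (t₁ + 1)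
    · have h1 : f t ≤ f (q * (t₁ + 1)) := hfm ht.le
      have h2 : 0 ≤ 2 * (Q * (1 + 2 * (q : ℝ))) := by positivity
      linarith [hUf t]
    · push Not at ht
      have hd : t₁ + 1 ≤ (t + 1) / q := by
        rw [Nat.le_div_iff_mul_le (by omega)]
        rw [mul_comm] at ht
        omega
      -- The block starts at s + 1 = ⌊(t + 1)/q⌋, so that t + 1 lies between q(s + 1) and q(s + 2),
      -- hence below 2q(s + 1).
      set s := (t + 1) / q - 1 with hs
      have hs1 : s + 1 = (t + 1) / q := by omega
      have hq2 : 2 ≤ q := by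
        have : (2 : ℝ) ≤ q := by linarith
        exact_mod_cast this
      have h1 : (s + 1) * q ≤ t + 1 := by rw [hs1]; exact Nat.div_mul_le_self _ _
      have h2 : t + 1 < (s + 2) * q := by
        have := Nat.lt_div_mul_add (a := t + 1) (show 0 < q by omega)
        rw [← hs1] at this
        linarith
      have hst : s < t := by nlinarith
      have h3 := hU2 s t (by omega) hst.le
      have h4 := ih s hst
      set K := f (q * (t₁ + 1)) + 2 * (Q * (1 + 2 * (q : ℝ))) + 1 with hK
      have h1' : ((s : ℝ) + 1) * q ≤ (t : ℝ) + 1 := by exact_mod_cast h1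
      have h2' : (t : ℝ) + 1 ≤ ((s : ℝ) + 2) * q := by exact_mod_cast h2.le
      have hs0 : (0 : ℝ) < (s : ℝ) + 1 := by positivity
      have ht0 : (0 : ℝ) < (t : ℝ) + 1 := by positivity
      have h5 : H * (((s : ℝ) + 1) / ((t : ℝ) + 1)) ≤ 1 / 2 := by
        rw [← mul_div_assoc, div_le_iff₀ ht0]
        nlinarith
      have h6 : ((t : ℝ) - s) / ((s : ℝ) + 1) ≤ 2 * q := by
        rw [div_le_iff₀ hs0]
        have : (0 : ℝ) ≤ s := Nat.cast_nonneg s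
        nlinarith
      have h7 : (H * (((s : ℝ) + 1) / ((t : ℝ) + 1)) + P) * U s ≤ (1 / 2 + P) * K := by
        have := hU s
        gcongr
      have h8 : Q * (1 + ((t : ℝ) - s) / ((s : ℝ) + 1)) ≤ Q * (1 + 2 * q) := by gcongr
      have h9 : 2 * (Q * (1 + 2 * (q : ℝ))) ≤ K := by
        have := hf0 (q * (t₁ + 1))
        linarith
      have h10 : (1 + P) * U t ≤ (1 + P) * K := by linarith
      exact le_of_mul_le_mul_left h10 (by positivity)

/-! ### The adjoint recursion and its response to noise -/

theorem exists_backward_orbit {α : Type*} (f : ℕ → α → α) (t : ℕ) (p : α) :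
    ∃ u : ℕ → α, u t = p ∧ ∀ j < t, u j = f j (u (j + 1)) := by
  induction t generalizing p with
  | zero => exact ⟨fun _ => p, rfl, fun j hj => absurd hj (Nat.not_lt_zero j)⟩
  | succ t ih =>
    obtain ⟨u, hu, h⟩ := ih (f t p)
    refine ⟨fun j => if j ≤ t then u j else p, by simp, fun j hj => ?_⟩
    rcases Nat.lt_succ_iff_lt_or_eq.1 hj with h1 | rfl
    · simp only [if_pos h1.le, if_pos (show j + 1 ≤ t from h1)]
      exact h j h1
    · simp [hu]

/-- The adjoint of the error dynamics up to time `t`, run backwards in time from `(v t, w t)`. -/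
structure AdjointProcess (x : ℕ → ℝ) (γ : ℝ) (t : ℕ) (v w : ℕ → ℝ) : Prop where
  fst_eq : ∀ j < t, v j = v (j + 1)
    + (1 - γ) * ((v (j + 1) + x j * w (j + 1)) * gramInvFst x j (x j))
  snd_eq : ∀ j < t, w j = w (j + 1)
    + (1 - γ) * ((v (j + 1) + x j * w (j + 1)) * gramInvSnd x j (x j))

theorem AdjointProcess.exists (x : ℕ → ℝ) (γ : ℝ) (t : ℕ) (p q : ℝ) :
    ∃ v w : ℕ → ℝ, v t = p ∧ w t = q ∧ AdjointProcess x γ t v w := by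
  obtain ⟨u, hu, h⟩ := exists_backward_orbit (fun j (z : ℝ × ℝ) =>
    (z.1 + (1 - γ) * ((z.1 + x j * z.2) * gramInvFst x j (x j)),
      z.2 + (1 - γ) * ((z.1 + x j * z.2) * gramInvSnd x j (x j)))) t (p, q)
  exact ⟨fun j => (u j).1, fun j => (u j).2, by simp [hu], by simp [hu],
    fun j hj => congrArg Prod.fst (h j hj), fun j hj => congrArg Prod.snd (h j hj)⟩

namespace AdjointProcess

variable {x : ℕ → ℝ} {γ : ℝ} {t : ℕ} {v w : ℕ → ℝ}

theorem sub_eq (h : AdjointProcess x γ t v w) {j : ℕ} (hj : j ≤ t) :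
    v j - v t = (1 - γ) * ∑ i ∈ Finset.Ico j t,
        (v (i + 1) + x i * w (i + 1)) * gramInvFst x i (x i)
    ∧ w j - w t = (1 - γ) * ∑ i ∈ Finset.Ico j t,
        (v (i + 1) + x i * w (i + 1)) * gramInvSnd x i (x i) := by
  induction hj using Nat.decreasingInduction with
  | self => simp
  | of_succ j hj ih =>
    rw [Finset.sum_eq_sum_Ico_succ_bot hj, Finset.sum_eq_sum_Ico_succ_bot hj, mul_add, mul_add,
      ← ih.1, ← ih.2, h.fst_eq j hj, h.snd_eq j hj]
    constructor <;> ring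

variable {X c Γ : ℝ} {t₀ : ℕ}

/-- The increments of the adjoint are y_i G_i⁻¹ φ_i up to the factor 1 - γ, and |G_i⁻¹ φ_i| = O(1/s)
on the block. Cauchy–Schwarz then bounds the drift by Σ y_i². -/
theorem sub_sq_le (h : AdjointProcess x γ t v w) (hx : IsExcited x X c t₀) (hc : 0 < c)
    (hγ : 1 ≤ γ) (hΓ : γ ≤ Γ) {s j : ℕ} (hs : t₀ ≤ s) (hsj : s ≤ j) (hj : j ≤ t) :
    (v j - v t) ^ 2 + (w j - w t) ^ 2
      ≤ Γ ^ 2 * (((t : ℝ) - s) * (((2 + X ^ 2) / c / ((s : ℝ) + 1)) ^ 2 * (2 + X ^ 2)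
        * ∑ i ∈ Finset.Ico s t, (v (i + 1) + x i * w (i + 1)) ^ 2)) := by
  obtain ⟨h1, h2⟩ := h.sub_eq hj
  set y : ℕ → ℝ := fun i => v (i + 1) + x i * w (i + 1) with hy
  have h3 := sq_sum_le_card_mul_sum_sq (s := Finset.Ico j t)
    (f := fun i => y i * gramInvFst x i (x i))
  have h4 := sq_sum_le_card_mul_sum_sq (s := Finset.Ico j t)
    (f := fun i => y i * gramInvSnd x i (x i))
  have h5 : (∑ i ∈ Finset.Ico j t, (y i * gramInvFst x i (x i)) ^ 2)
      + ∑ i ∈ Finset.Ico j t, (y i * gramInvSnd x i (x i)) ^ 2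
      ≤ ((2 + X ^ 2) / c / ((s : ℝ) + 1)) ^ 2 * (2 + X ^ 2) * ∑ i ∈ Finset.Ico s t, y i ^ 2 := by
    rw [← Finset.sum_add_distrib, Finset.mul_sum]
    refine (Finset.sum_le_sum fun i hi => ?_).trans
      (Finset.sum_le_sum_of_subset_of_nonneg (Finset.Ico_subset_Ico_left hsj)
        fun i _ _ => by positivity)
    have hi' := Finset.mem_Ico.1 hi
    have hsi : (s : ℝ) ≤ i := by exact_mod_cast hsj.trans hi'.1
    have e1 := gramInv_sq_le x i (x i)
    have e2 := gramRatio_le_div x hx.bound hc (hx.le_det i (hs.trans (hsj.trans hi'.1)))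
    have e3 : gramRatio x i ≤ (2 + X ^ 2) / c / ((s : ℝ) + 1) := e2.trans (by gcongr)
    have e4 := hx.one_add_sq_le i
    have e5 := gramRatio_nonneg x i
    calc (y i * gramInvFst x i (x i)) ^ 2 + (y i * gramInvSnd x i (x i)) ^ 2
        = (gramInvFst x i (x i) ^ 2 + gramInvSnd x i (x i) ^ 2) * y i ^ 2 := by ring
      _ ≤ (gramRatio x i ^ 2 * (1 + x i ^ 2)) * y i ^ 2 := by gcongr
      _ ≤ _ := by gcongr
  have h6 : ((Finset.Ico j t).card : ℝ) ≤ (t : ℝ) - s := by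
    rw [Nat.card_Ico, Nat.cast_sub hj]
    have : (s : ℝ) ≤ j := by exact_mod_cast hsj
    linarith
  have h7 : (1 - γ) ^ 2 ≤ Γ ^ 2 := by nlinarith
  rw [h1, h2, mul_pow, mul_pow, ← mul_add]
  have h8 : (∑ i ∈ Finset.Ico j t, y i * gramInvFst x i (x i)) ^ 2
      + (∑ i ∈ Finset.Ico j t, y i * gramInvSnd x i (x i)) ^ 2
      ≤ ((t : ℝ) - s) * (((2 + X ^ 2) / c / ((s : ℝ) + 1)) ^ 2 * (2 + X ^ 2)
        * ∑ i ∈ Finset.Ico s t, y i ^ 2) := by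
    refine (add_le_add h3 h4).trans ?_
    rw [← mul_add]
    have h9 : (0 : ℝ) ≤ (t : ℝ) - s := by
      have : (s : ℝ) ≤ t := by exact_mod_cast hsj.trans hj
      linarith
    exact mul_le_mul h6 h5 (by positivity) h9
  exact mul_le_mul h7 h8 (by positivity) (by positivity)

/-- Each period adds the rank-one matrix φφᵀ to the normal matrix, so the sum is the form of G_t -
G_s. -/
theorem sum_sq_eq_gramForm_sub (x : ℕ → ℝ) {s t : ℕ} (hst : s ≤ t) (p q : ℝ) :
    ∑ j ∈ Finset.Ico s t, (p + x j * q) ^ 2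
      = gramForm ((t : ℝ) + 1) (firstMoment x t) (secondMoment x t) p q
        - gramForm ((s : ℝ) + 1) (firstMoment x s) (secondMoment x s) p q := by
  induction t, hst using Nat.le_induction with
  | base => simp
  | succ t hst ih =>
    rw [Finset.sum_Ico_succ_top hst, ih, firstMoment_succ, secondMoment_succ, Nat.cast_succ,
      gramForm_add_rank_one, smul_eq_mul, Real.norm_eq_abs, sq_abs]
    ring

theorem add_mul_sq_le (p q p' q' z : ℝ) : (p + z * q) ^ 2
    ≤ 2 * (p' + z * q') ^ 2 + 2 * ((1 + z ^ 2) * ((p' - p) ^ 2 + (q' - q) ^ 2)) := by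
  have h1 := sq_nonneg (z * (p' - p) - (q' - q))
  have h2 := sq_nonneg (p' + z * q' + ((p' - p) + z * (q' - q)))
  linarith

/-- A process with terminal value the inverse normal matrix applied to the regressor at time `t`
has a substantial response to the noise. -/
theorem le_sum_sq (h : AdjointProcess x γ t v w) (hx : IsExcited x X c t₀) (hc : 0 < c)
    (hγ : 1 ≤ γ) (hΓ : γ ≤ Γ) (hv : v t = gramInvFst x t (x t)) (hw : w t = gramInvSnd x t (x t))
    {s : ℕ} (hs : t₀ ≤ s) (hst : s ≤ t) {q : ℝ}
    (hq : 2 * ((2 + X ^ 2) ^ 2 / c) * ((s : ℝ) + 1) ≤ (t : ℝ) + 1)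
    (hq' : (t : ℝ) + 1 ≤ 2 * q * ((s : ℝ) + 1)) :
    c / (2 * (2 + X ^ 2) ^ 3) / ((t : ℝ) + 1)
      ≤ 2 * (1 + Γ ^ 2 * (2 + X ^ 2) ^ 4 / c ^ 2 * (2 * q) ^ 2)
        * ∑ i ∈ Finset.Ico s t, (v (i + 1) + x i * w (i + 1)) ^ 2 := by
  set L := 2 + X ^ 2 with hL
  have hL0 : 0 < L := by positivity
  set Q := ∑ i ∈ Finset.Ico s t, (v (i + 1) + x i * w (i + 1)) ^ 2 with hQ
  have hQ0 : 0 ≤ Q := Finset.sum_nonneg fun i _ => sq_nonneg _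
  have hs0 : (0 : ℝ) < (s : ℝ) + 1 := by positivity
  have ht0 : (0 : ℝ) < (t : ℝ) + 1 := by positivity
  have hst' : (0 : ℝ) ≤ (t : ℝ) - s := by
    have : (s : ℝ) ≤ t := by exact_mod_cast hst
    linarith
  set W := Γ ^ 2 * (((t : ℝ) - s) * ((L / c / ((s : ℝ) + 1)) ^ 2 * L * Q)) with hW
  have hW0 : 0 ≤ W := by positivity
  set V := v t ^ 2 + w t ^ 2 with hV
  -- The response of the frozen terminal vector is compared with the actual response; the error is
  -- the drift W.
  have h1 : ∑ j ∈ Finset.Ico s t, (v t + x j * w t) ^ 2 ≤ 2 * Q + ((t : ℝ) - s) * (2 * (L * W)) := by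
    have e : ((t : ℝ) - s) * (2 * (L * W)) = ∑ j ∈ Finset.Ico s t, 2 * (L * W) := by
      rw [Finset.sum_const, Nat.card_Ico, nsmul_eq_mul, Nat.cast_sub hst]
    rw [e, hQ, Finset.mul_sum, ← Finset.sum_add_distrib]
    refine Finset.sum_le_sum fun j hj => ?_
    have hj' := Finset.mem_Ico.1 hj
    have e1 := h.sub_sq_le hx hc hγ hΓ hs (j := j + 1) (by omega) (by omega)
    have e2 := hx.one_add_sq_le j
    have e3 : (1 + x j ^ 2) * ((v (j + 1) - v t) ^ 2 + (w (j + 1) - w t) ^ 2) ≤ L * W :=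
      mul_le_mul e2 e1 (by positivity) hL0.le
    linarith [add_mul_sq_le (v t) (w t) (v (j + 1)) (w (j + 1)) (x j)]
  rw [sum_sq_eq_gramForm_sub x hst] at h1
  have h2 := norm_sq_le_gramRatio_mul x t (v t) (w t)
  have h3 := gramForm_le_trace_mul (by linarith [one_le_secondMoment x s])
    (firstMoment_sq_le x s) (v t) (w t)
  have h4 := gramForm_le_trace_mul (by linarith [one_le_secondMoment x t])
    (firstMoment_sq_le x t) (v t) (w t)
  have h5 := gramForm_image ((t : ℝ) + 1) (firstMoment x t) (secondMoment x t) (v t) (w t)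
  have h6 := gramForm_nonneg (by positivity) (firstMoment_sq_le x t) (v t) (w t)
  simp only [smul_eq_mul, Real.norm_eq_abs, sq_abs] at h2 h3 h4 h5
  rw [← hV] at h2 h3 h4 h5
  set φ := gramForm ((t : ℝ) + 1) (firstMoment x t) (secondMoment x t) (v t) (w t) with hφ
  have hV0 : 0 ≤ V := by positivity
  have h7 : V ≤ L / c / ((t : ℝ) + 1) * φ :=
    h2.trans (mul_le_mul_of_nonneg_right
      (gramRatio_le_div x hx.bound hc (hx.le_det t (hs.trans hst))) h6)
  have h8 : c / L * ((t : ℝ) + 1) * V ≤ φ := by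
    calc c / L * ((t : ℝ) + 1) * V ≤ c / L * ((t : ℝ) + 1) * (L / c / ((t : ℝ) + 1) * φ) := by
          gcongr
      _ = φ := by field_simp
  have h9 : (((s : ℝ) + 1) + secondMoment x s) * V ≤ L * ((s : ℝ) + 1) * V :=
    mul_le_mul_of_nonneg_right (trace_le x hx.bound s) hV0
  -- By `hq` the matrix G_s takes away at most half of the lower bound for G_t.
  have h10 : L * ((s : ℝ) + 1) ≤ c / (2 * L) * ((t : ℝ) + 1) := by
    calc L * ((s : ℝ) + 1) = c / (2 * L) * (2 * (L ^ 2 / c) * ((s : ℝ) + 1)) := by field_simp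
      _ ≤ _ := by gcongr
  have h11 : c / (2 * L) * ((t : ℝ) + 1) * V ≤ 2 * Q + ((t : ℝ) - s) * (2 * (L * W)) := by
    have e := mul_le_mul_of_nonneg_right h10 hV0
    have e2 : c / L * ((t : ℝ) + 1) * V = 2 * (c / (2 * L) * ((t : ℝ) + 1) * V) := by
      field_simp
    linarith
  -- The image of (v t, w t) under G_t is the regressor (1, x t), of norm at least 1, and the trace
  -- bounds how much G_t can stretch.
  have h12 : 1 ≤ (L * ((t : ℝ) + 1)) ^ 2 * V := by
    have e1 := gramInv_fst_eq x t (x t)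
    have e2 := gramInv_snd_eq x t (x t)
    rw [← hv, ← hw] at e1 e2
    rw [e1, e2] at h5
    have e3 : 0 ≤ (((t : ℝ) + 1) * secondMoment x t - firstMoment x t ^ 2) * V :=
      mul_nonneg (by linarith [firstMoment_sq_le x t]) hV0
    have e4 := trace_le x hx.bound t
    rw [← hL] at e4
    have e5 : 0 ≤ ((t : ℝ) + 1) + secondMoment x t := by linarith [one_le_secondMoment x t]
    have e6 := mul_le_mul_of_nonneg_left h4 e5
    have e7 : ((((t : ℝ) + 1) + secondMoment x t)) * ((((t : ℝ) + 1) + secondMoment x t) * V)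
        ≤ (L * ((t : ℝ) + 1)) * ((L * ((t : ℝ) + 1)) * V) := by gcongr
    have e8 := sq_nonneg (x t)
    rw [sq (L * _), mul_assoc]
    linarith
  have h13 : c / (2 * L ^ 3) / ((t : ℝ) + 1) ≤ c / (2 * L) * ((t : ℝ) + 1) * V := by
    calc c / (2 * L ^ 3) / ((t : ℝ) + 1) = c / (2 * L ^ 3) / ((t : ℝ) + 1) * 1 := by ring
      _ ≤ c / (2 * L ^ 3) / ((t : ℝ) + 1) * ((L * ((t : ℝ) + 1)) ^ 2 * V) := by gcongr
      _ = _ := by field_simp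
  have h14 : ((t : ℝ) - s) / ((s : ℝ) + 1) ≤ 2 * q := by
    rw [div_le_iff₀ hs0]
    have : (0 : ℝ) ≤ s := Nat.cast_nonneg s
    linarith
  have h15 : ((t : ℝ) - s) * (2 * (L * W))
      = 2 * (Γ ^ 2 * L ^ 4 / c ^ 2 * (((t : ℝ) - s) / ((s : ℝ) + 1)) ^ 2) * Q := by
    rw [hW]; field_simp
  have h16 : 2 * (Γ ^ 2 * L ^ 4 / c ^ 2 * (((t : ℝ) - s) / ((s : ℝ) + 1)) ^ 2) * Q
      ≤ 2 * (Γ ^ 2 * L ^ 4 / c ^ 2 * (2 * q) ^ 2) * Q := by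
    have : 0 ≤ ((t : ℝ) - s) / ((s : ℝ) + 1) := by positivity
    gcongr
  linarith

end AdjointProcess

namespace ErrorProcess

variable {E : Type*} [NormedAddCommGroup E] [InnerProductSpace ℝ E]
  {x : ℕ → ℝ} {γ τ : ℝ} {a b ξ : ℕ → E}

theorem residual_eq_image (x : ℕ → ℝ) (a b : ℕ → E) (t : ℕ) :
    gramInvFst x t (x t) • (((t : ℝ) + 1) • a t + firstMoment x t • b t)
      + gramInvSnd x t (x t) • (firstMoment x t • a t + secondMoment x t • b t)
      = a t + x t • b t := by
  have e1 : ∀ (p q A B C : ℝ) (u w : E), p • (A • u + B • w) + q • (B • u + C • w)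
      = (A * p + B * q) • u + (B * p + C * q) • w := fun p q A B C u w => by module
  rw [e1, gramInv_fst_eq, gramInv_snd_eq, one_smul]

/-- Pairing the adjoint with the image of the error cancels the feedback term with factor 1 - γ in
each step; only the noise input remains. -/
theorem adjoint_image_eq (h : ErrorProcess x γ τ a b ξ) {T : ℕ} {v w : ℕ → ℝ}
    (hv : AdjointProcess x γ T v w) {s t : ℕ} (hst : s ≤ t) (htT : t ≤ T) :
    v t • (((t : ℝ) + 1) • a t + firstMoment x t • b t)
      + w t • (firstMoment x t • a t + secondMoment x t • b t)
      = v s • (((s : ℝ) + 1) • a s + firstMoment x s • b s)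
        + w s • (firstMoment x s • a s + secondMoment x s • b s)
        - ∑ j ∈ Finset.Ico s t, (v (j + 1) + x j * w (j + 1)) • ξ j := by
  induction t, hst using Nat.le_induction with
  | base => simp
  | succ t hst ih =>
    obtain ⟨h1, h2⟩ := h.image_succ t
    have h3 := ih (by omega)
    have h4 := residual_eq_image x a b t
    rw [hv.fst_eq t htT, hv.snd_eq t htT] at h3
    rw [Finset.sum_Ico_succ_top hst, ← sub_sub, ← h3, h1, h2]
    set m := ((t : ℝ) + 1) • a t + firstMoment x t • b t
    set n := firstMoment x t • a t + secondMoment x t • b t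
    rw [← h4]
    module

/-- By Pythagoras: the part carried over from time s is orthogonal to the noise from s on, and
dropping it leaves the noise contribution. -/
theorem mul_sum_sq_le_residual_sq (h : ErrorProcess x γ τ a b ξ) {t : ℕ} {v w : ℕ → ℝ}
    (hv : AdjointProcess x γ t v w) (hvt : v t = gramInvFst x t (x t))
    (hwt : w t = gramInvSnd x t (x t)) {s : ℕ} (hst : s ≤ t) :
    τ * ∑ j ∈ Finset.Ico s t, (v (j + 1) + x j * w (j + 1)) ^ 2 ≤ ‖a t + x t • b t‖ ^ 2 := by
  have h1 := h.adjoint_image_eq hv hst le_rfl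
  rw [hvt, hwt, residual_eq_image] at h1
  set u := v s • (((s : ℝ) + 1) • a s + firstMoment x s • b s)
    + w s • (firstMoment x s • a s + secondMoment x s • b s) with hu
  have h4 : inner ℝ u (∑ j ∈ Finset.Ico s t, (v (j + 1) + x j * w (j + 1)) • ξ j) = 0 := by
    rw [inner_sum]
    refine Finset.sum_eq_zero fun j hj => ?_
    obtain ⟨h2, h3⟩ := h.inner_noise s j (Finset.mem_Ico.1 hj).1
    simp [hu, inner_add_left, real_inner_smul_left, real_inner_smul_right, h2, h3]
  rw [h1, norm_sub_sq_real, norm_sq_sum_of_orthogonal h.noise, h4]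
  linarith [sq_nonneg ‖u‖]

end ErrorProcess

/-! ### Two-sided bounds for the residuals -/

/-- The expected squared residuals are of exact order `1 / t`, with uniform constants. -/
theorem exists_residual_bounds (X c Γ τ M : ℝ) (t₀ : ℕ) (hc : 0 < c) (hτ : 0 < τ) :
    ∃ (k K : ℝ) (n₀ : ℕ), 0 < k ∧ 0 < K ∧
      ∀ {E : Type*} [NormedAddCommGroup E] [InnerProductSpace ℝ E] {x : ℕ → ℝ} {γ : ℝ}
        {a b ξ : ℕ → E}, ErrorProcess x γ τ a b ξ → IsExcited x X c t₀ → 1 ≤ γ → γ ≤ Γ →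
        ‖a 0‖ ^ 2 + ‖b 0‖ ^ 2 ≤ M →
        (∀ t : ℕ, ‖a t + x t • b t‖ ^ 2 ≤ K * (1 / ((t : ℝ) + 1))) ∧
        (∀ t : ℕ, n₀ ≤ t → k * (1 / ((t : ℝ) + 1)) ≤ ‖a t + x t • b t‖ ^ 2) := by
  set L := 2 + X ^ 2 with hL
  have hL0 : 0 < L := by positivity
  have hL1 : 1 ≤ L := by nlinarith [sq_nonneg X]
  set H := L ^ 2 / c with hH
  have hH0 : 0 < H := by positivity
  -- Beyond t₁ the leverage is small enough for the dissipation estimate.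
  obtain ⟨t₁, ht₁⟩ := exists_nat_ge (2 * (Γ ^ 2 * H))
  obtain ⟨K, hK0, hK⟩ := exists_bound_of_block_contraction (L * |M|) (1 + Γ ^ 2 * L ^ 4)
    (L ^ 2 * τ) (6 * H * Γ ^ 2) (3 * H * τ + 6 * H * Γ ^ 2 * (H * τ)) (3 * H) (max t₀ t₁)
    (by positivity) (le_add_of_nonneg_right (by positivity)) (by positivity) (by positivity)
    (by positivity) (by positivity)
  obtain ⟨q, hq⟩ := exists_nat_ge (2 * H + 2)
  have hq2 : 2 ≤ q := by
    have : (2 : ℝ) ≤ q := by linarith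
    exact_mod_cast this
  refine ⟨τ * (c / (2 * L ^ 3)) / (2 * (1 + Γ ^ 2 * L ^ 4 / c ^ 2 * (2 * q) ^ 2)),
    (H + L ^ 2 * ((t₀ : ℝ) + 1)) * K, q * (t₀ + 1), by positivity, by positivity,
    fun {E} _ _ {x γ a b ξ} h hx hγ hΓ hM => ⟨fun t => ?_, fun t ht => ?_⟩⟩
  · have hU : ErrorProcess.energy x a b t ≤ K := by
      refine hK _ (ErrorProcess.energy_nonneg x a b) ?_
        (fun t => h.energy_succ_le hx hγ hΓ hτ.le t) (fun s t hs hst => ?_) t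
      · have e1 := gramForm_le_trace_mul (by linarith [one_le_secondMoment x 0])
          (firstMoment_sq_le x 0) (a 0) (b 0)
        have e2 := trace_le x hx.bound 0
        rw [← ErrorProcess.energy] at e1
        refine e1.trans ?_
        rw [Nat.cast_zero, zero_add, mul_one, ← hL] at e2
        rw [Nat.cast_zero, zero_add]
        exact mul_le_mul e2 (hM.trans (le_abs_self M)) (by positivity) hL0.le
      · have e1 : (t₁ : ℝ) ≤ s := by exact_mod_cast (le_max_right t₀ t₁).trans hs
        have e2 := h.energy_block_le hx hc hγ hΓ hτ.le ((le_max_left _ _).trans hs)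
          (by linarith) hst hH
        refine e2.trans ?_
        have e3 : 0 ≤ ((t : ℝ) - s) / ((s : ℝ) + 1) := by
          have : (s : ℝ) ≤ t := by exact_mod_cast hst
          exact div_nonneg (by linarith) (by positivity)
        have e4 : 0 ≤ 3 * H * τ * (((t : ℝ) - s) / ((s : ℝ) + 1)) := by positivity
        have e5 : 0 ≤ 6 * H * Γ ^ 2 * (H * τ) := by positivity
        linarith
    have hU0 := ErrorProcess.energy_nonneg x a b t
    have ht0 : (0 : ℝ) < (t : ℝ) + 1 := by positivity
    -- Before t₀ there is no excitation; the trivial bound for the ratio suffices there, at the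
    -- price of the factor t₀ + 1.
    have hρ : L * gramRatio x t ≤ (H + L ^ 2 * ((t₀ : ℝ) + 1)) * (1 / ((t : ℝ) + 1)) := by
      rcases le_or_gt t₀ t with ht | ht
      · have e := gramRatio_le_div x hx.bound hc (hx.le_det t ht)
        calc L * gramRatio x t ≤ L * (L / c / ((t : ℝ) + 1)) := by gcongr
          _ = H * (1 / ((t : ℝ) + 1)) := by rw [hH]; field_simp
          _ ≤ _ := by
            gcongr
            exact le_add_of_nonneg_right (by positivity)
      · have e := gramRatio_le x hx.bound t
        have e2 : (t : ℝ) + 1 ≤ (t₀ : ℝ) + 1 := by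
          have : (t : ℝ) ≤ t₀ := by exact_mod_cast ht.le
          linarith
        calc L * gramRatio x t ≤ L * L := by gcongr
          _ ≤ L ^ 2 * ((t₀ : ℝ) + 1) * (1 / ((t : ℝ) + 1)) := by
            rw [mul_one_div, le_div_iff₀ ht0, sq]
            gcongr
          _ ≤ _ := by
            gcongr
            exact le_add_of_nonneg_left hH0.le
    calc ‖a t + x t • b t‖ ^ 2 ≤ L * (gramRatio x t * ErrorProcess.energy x a b t) :=
          ErrorProcess.residual_sq_le hx t
      _ = L * gramRatio x t * ErrorProcess.energy x a b t := by ring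
      _ ≤ (H + L ^ 2 * ((t₀ : ℝ) + 1)) * (1 / ((t : ℝ) + 1)) * K := by gcongr
      _ = _ := by ring
  · have hd : t₀ + 1 ≤ (t + 1) / q := by
      rw [Nat.le_div_iff_mul_le (by omega)]
      rw [mul_comm] at ht
      omega
    set s := (t + 1) / q - 1 with hs
    have hs1 : s + 1 = (t + 1) / q := by omega
    have h1 : (s + 1) * q ≤ t + 1 := by rw [hs1]; exact Nat.div_mul_le_self _ _
    have h2 : t + 1 < (s + 2) * q := by
      have := Nat.lt_div_mul_add (a := t + 1) (show 0 < q by omega)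
      rw [← hs1] at this
      linarith
    have hst : s < t := by nlinarith
    have h1' : ((s : ℝ) + 1) * q ≤ (t : ℝ) + 1 := by exact_mod_cast h1
    have h2' : (t : ℝ) + 1 ≤ ((s : ℝ) + 2) * q := by exact_mod_cast h2.le
    have hs0 : (0 : ℝ) ≤ s := Nat.cast_nonneg s
    obtain ⟨v, w, hv, hw, hvw⟩ :=
      AdjointProcess.exists x γ t (gramInvFst x t (x t)) (gramInvSnd x t (x t))
    have h3 := h.mul_sum_sq_le_residual_sq hvw hv hw hst.le
    have h4 := hvw.le_sum_sq hx hc hγ hΓ hv hw (s := s) (by omega) hst.le (q := q)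
      (by rw [← hL, ← hH]; nlinarith) (by nlinarith)
    rw [← hL] at h4
    have h5 := mul_le_mul_of_nonneg_left h4 hτ.le
    rw [div_mul_eq_mul_div, div_le_iff₀ (by positivity)]
    have h6 := mul_le_mul_of_nonneg_left h3
      (show 0 ≤ 2 * (1 + Γ ^ 2 * L ^ 4 / c ^ 2 * (2 * (q : ℝ)) ^ 2) by positivity)
    calc τ * (c / (2 * L ^ 3)) * (1 / ((t : ℝ) + 1))
        = τ * (c / (2 * L ^ 3) / ((t : ℝ) + 1)) := by ring
      _ ≤ _ := h5
      _ ≤ _ := by linarith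

/-! ### The recursive least squares pricing policy -/

theorem firstMoment_congr {x y : ℕ → ℝ} {t : ℕ} (h : ∀ s < t, x s = y s) :
    firstMoment x t = firstMoment y t :=
  Finset.sum_congr rfl fun s hs => h s (Finset.mem_range.1 hs)

theorem secondMoment_congr {x y : ℕ → ℝ} {t : ℕ} (h : ∀ s < t, x s = y s) :
    secondMoment x t = secondMoment y t := by
  rw [secondMoment, secondMoment,
    Finset.sum_congr rfl fun s hs => by rw [h s (Finset.mem_range.1 hs)]]

/-- The gains at time t depend only on the regressors before t, so the policy, which continues the
known targets by 0, computes the true gains. -/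
theorem gramInv_congr {x y : ℕ → ℝ} {t : ℕ} (h : ∀ s < t, x s = y s) (z : ℝ) :
    gramInvFst x t z = gramInvFst y t z ∧ gramInvSnd x t z = gramInvSnd y t z := by
  simp only [gramInvFst, gramInvSnd, gramDet, firstMoment_congr h, secondMoment_congr h, and_self]

/-- The targets known in period `t`, continued by `0`. -/
def extendTargets {t : ℕ} (d : Fin (t + 1) → ℝ) (s : ℕ) : ℝ :=
  if h : s < t + 1 then d ⟨s, h⟩ else 0

theorem extendTargets_apply (d : ℕ → ℝ) {s t : ℕ} (h : s ≤ t) :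
    extendTargets (fun r : Fin (t + 1) => d r) s = d s :=
  dif_pos (Nat.lt_succ_of_le h)

variable {N : ℕ}

/-- The observable gradient of the cost in a period with target `z`, price `o.1` and
responses `o.2`. -/
def costGradient (Y z : ℝ) (o : ℝ × (Fin N → ℝ)) : ℝ :=
  ((∑ i, o.2 i) - Y * z + N * o.1) / N

/-- The pricing policy which charges an affine function of the target, and updates its
coefficients by a recursive least squares step along the observed gradients. -/
def leastSquaresPolicy (N : ℕ) : PricingPolicy N where
  -- The coefficients start at 0, and the gain of period s uses the matrix of time s + 1, which
  -- involves only the targets up to s.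
  price Y t d H := -∑ s : Fin t,
    (gramInvFst (extendTargets d) (s + 1) (extendTargets d s)
      + extendTargets d t * gramInvSnd (extendTargets d) (s + 1) (extendTargets d s))
      * costGradient Y (extendTargets d s) (H s)
  measurable_price Y t d := by
    refine (Finset.measurable_sum _ fun s _ => Measurable.const_mul ?_ _).neg
    unfold costGradient
    fun_prop

theorem PricingPolicy.onlinePrice_eq (p : PricingPolicy N) (u : Users N) (Y : ℝ) (d : ℕ → ℝ)
    (e : ℕ → Fin N → ℝ) (t : ℕ) :
    p.onlinePrice u Y d e t = p.price Y t (fun s => d s) (fun s : Fin t =>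
      (p.onlinePrice u Y d e s, fun i => u.response (p.onlinePrice u Y d e s) i + e s i)) := by
  rw [PricingPolicy.onlinePrice]

/-- The sum of the price sensitivities `1 / β i` of the users. -/
def Users.sensitivity (u : Users N) : ℝ := ∑ i, 1 / u.β i

/-- The intercept of the full-information price as a function of the target. -/
def Users.intercept (u : Users N) : ℝ := (∑ i, u.α i / u.β i) / (N * (1 + u.sensitivity))

theorem Users.sum_response (u : Users N) (l : ℝ) :
    ∑ i, u.response l i = N * u.sensitivity * l - ∑ i, u.α i / u.β i := by
  rw [Users.sensitivity, Finset.mul_sum, Finset.sum_mul, ← Finset.sum_sub_distrib]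
  refine Finset.sum_congr rfl fun i _ => ?_
  rw [Users.response]; ring

theorem Users.offlinePrice_eq (u : Users N) (Y d : ℝ) :
    u.offlinePrice Y d = u.intercept + d * (Y / (N * (1 + u.sensitivity))) := by
  have h : (N : ℝ) + ∑ i, (N : ℝ) / u.β i = N * (1 + u.sensitivity) := by
    rw [Users.sensitivity, mul_add, mul_one, Finset.mul_sum]
    simp only [mul_one_div]
  rw [Users.offlinePrice, Users.intercept, h]
  ring

theorem Users.sensitivity_nonneg {u : Users N} (hβ : ∀ i, 0 < u.β i) : 0 ≤ u.sensitivity :=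
  Finset.sum_nonneg fun i _ => (one_div_pos.2 (hβ i)).le

/-- The users' coefficients enter the mean only through the zero, which is the full-information
price, and through the slope, which does not depend on the target. -/
theorem costGradient_response (hN : 0 < N) {u : Users N} (hβ : ∀ i, 0 < u.β i) (Y z l : ℝ)
    (e : Fin N → ℝ) :
    costGradient Y z (l, fun i => u.response l i + e i)
      = (1 + u.sensitivity) * (l - u.offlinePrice Y z) + (∑ i, e i) / N := by
  have hN' : (N : ℝ) ≠ 0 := by positivity
  have hs : 1 + u.sensitivity ≠ 0 := by
    have := Users.sensitivity_nonneg hβ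
    positivity
  rw [costGradient, Finset.sum_add_distrib, Users.sum_response, Users.offlinePrice_eq,
    Users.intercept]
  field_simp
  ring

/-- The error of the intercept of the policy in period `t`. -/
def interceptError (u : Users N) (Y : ℝ) (d : ℕ → ℝ) (e : ℕ → Fin N → ℝ) (t : ℕ) : ℝ :=
  -u.intercept - ∑ s ∈ Finset.range t, gramInvFst d (s + 1) (d s)
    * ((1 + u.sensitivity) * ((leastSquaresPolicy N).onlinePrice u Y d e s
      - u.offlinePrice Y (d s)) + (∑ i, e s i) / N)

/-- The error of the slope of the policy in period `t`. -/
def slopeError (u : Users N) (Y : ℝ) (d : ℕ → ℝ) (e : ℕ → Fin N → ℝ) (t : ℕ) : ℝ :=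
  -(Y / (N * (1 + u.sensitivity))) - ∑ s ∈ Finset.range t, gramInvSnd d (s + 1) (d s)
    * ((1 + u.sensitivity) * ((leastSquaresPolicy N).onlinePrice u Y d e s
      - u.offlinePrice Y (d s)) + (∑ i, e s i) / N)

section Errors

variable {u : Users N}

theorem onlinePrice_sub_offlinePrice (hN : 0 < N) (hβ : ∀ i, 0 < u.β i) (Y : ℝ) (d : ℕ → ℝ)
    (e : ℕ → Fin N → ℝ) (t : ℕ) :
    (leastSquaresPolicy N).onlinePrice u Y d e t - u.offlinePrice Y (d t)
      = interceptError u Y d e t + d t * slopeError u Y d e t := by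
  have h1 : (leastSquaresPolicy N).onlinePrice u Y d e t = -∑ s ∈ Finset.range t,
      (gramInvFst d (s + 1) (d s) + d t * gramInvSnd d (s + 1) (d s))
      * ((1 + u.sensitivity) * ((leastSquaresPolicy N).onlinePrice u Y d e s
        - u.offlinePrice Y (d s)) + (∑ i, e s i) / N) := by
    rw [PricingPolicy.onlinePrice_eq, Finset.sum_range]
    simp only [leastSquaresPolicy]
    congr 1
    refine Finset.sum_congr rfl fun s _ => ?_
    have hs := s.isLt
    obtain ⟨h2, h3⟩ := gramInv_congr (x := extendTargets (fun r : Fin (t + 1) => d r)) (y := d)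
      (t := (s : ℕ) + 1) (fun r hr => extendTargets_apply d (by omega)) (d s)
    rw [extendTargets_apply d hs.le, extendTargets_apply d le_rfl, h2, h3,
      costGradient_response hN hβ]
  rw [h1, Users.offlinePrice_eq, interceptError, slopeError]
  simp only [add_mul, Finset.sum_add_distrib, mul_sub, Finset.mul_sum]
  simp only [mul_assoc]
  ring

theorem interceptError_succ (hN : 0 < N) (hβ : ∀ i, 0 < u.β i) (Y : ℝ) (d : ℕ → ℝ)
    (e : ℕ → Fin N → ℝ) (t : ℕ) :
    interceptError u Y d e (t + 1) = interceptError u Y d e t - gramInvFst d (t + 1) (d t)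
      * ((1 + u.sensitivity) * (interceptError u Y d e t + d t * slopeError u Y d e t)
        + (∑ i, e t i) / N) := by
  rw [← onlinePrice_sub_offlinePrice hN hβ, interceptError, Finset.sum_range_succ, ← sub_sub]
  rfl

theorem slopeError_succ (hN : 0 < N) (hβ : ∀ i, 0 < u.β i) (Y : ℝ) (d : ℕ → ℝ)
    (e : ℕ → Fin N → ℝ) (t : ℕ) :
    slopeError u Y d e (t + 1) = slopeError u Y d e t - gramInvSnd d (t + 1) (d t)
      * ((1 + u.sensitivity) * (interceptError u Y d e t + d t * slopeError u Y d e t)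
        + (∑ i, e t i) / N) := by
  rw [← onlinePrice_sub_offlinePrice hN hβ, slopeError, Finset.sum_range_succ, ← sub_sub]
  rfl

/-- The cost difference caused by a deviation from the full-information price. -/
theorem cost_response_sub (hN : 0 < N) (hβ : ∀ i, 0 < u.β i) (Y z l : ℝ) (e : Fin N → ℝ) :
    u.cost Y z (fun i => u.response l i + e i)
      = u.cost Y z (fun i => u.response (u.offlinePrice Y z) i + e i)
        + (N / 2 * (u.sensitivity + u.sensitivity ^ 2) * (l - u.offlinePrice Y z) ^ 2
          + N * (1 + u.sensitivity) * ((l - u.offlinePrice Y z) * ((∑ i, e i) / N))) := by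
  have hN' : (N : ℝ) ≠ 0 := by positivity
  have hs : 1 + u.sensitivity ≠ 0 := by
    have := Users.sensitivity_nonneg hβ
    positivity
  set m := u.offlinePrice Y z with hm
  have h1 : ∑ i, (1 / (N : ℝ) * u.userCost i (u.response l i + e i)
      - 1 / (N : ℝ) * u.userCost i (u.response m i + e i))
      = N / 2 * u.sensitivity * (l ^ 2 - m ^ 2) - (l - m) * (∑ i, u.α i / u.β i)
        + (l - m) * ∑ i, e i + (l - m) * (∑ i, u.α i / u.β i) := by
    rw [Users.sensitivity, Finset.mul_sum, Finset.sum_mul, Finset.mul_sum, Finset.mul_sum,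
      ← Finset.sum_sub_distrib, ← Finset.sum_add_distrib, ← Finset.sum_add_distrib]
    refine Finset.sum_congr rfl fun i _ => ?_
    have := (hβ i).ne'
    simp only [Users.userCost, Users.response]
    field_simp
    ring
  rw [Finset.sum_sub_distrib] at h1
  -- The target is eliminated through the optimality equation for m, so that the deterministic terms
  -- linear in l - m cancel.
  have h2 : Y * z = N * (1 + u.sensitivity) * m - ∑ i, u.α i / u.β i := by
    rw [hm, Users.offlinePrice_eq, Users.intercept]
    field_simp
    ring
  simp only [Users.cost, Finset.sum_add_distrib, Users.sum_response]
  rw [h2]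
  have h3 := eq_add_of_sub_eq h1
  rw [h3]
  field_simp
  ring

end Errors

/-! ### The error process in `L²` -/

section L2

variable {Ω : Type*} [MeasurableSpace Ω] {P : Measure Ω}

theorem inner_toLp {f g : Ω → ℝ} (hf : MemLp f 2 P) (hg : MemLp g 2 P) :
    inner ℝ (hf.toLp f) (hg.toLp g) = ∫ ω, f ω * g ω ∂P := by
  rw [L2.inner_def]
  refine integral_congr_ae ?_
  filter_upwards [hf.coeFn_toLp, hg.coeFn_toLp] with ω h1 h2
  rw [h1, h2]
  simp [mul_comm]

theorem norm_sq_toLp {f : Ω → ℝ} (hf : MemLp f 2 P) :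
    ‖hf.toLp f‖ ^ 2 = ∫ ω, f ω ^ 2 ∂P := by
  rw [← real_inner_self_eq_norm_sq, inner_toLp]
  simp only [sq]

variable {N : ℕ} {ε : ℕ → Fin N → Ω → ℝ} {v : ℝ≥0}

theorem IsGaussianNoise.memLp (hε : IsGaussianNoise ε v P) (t : ℕ) (i : Fin N) :
    MemLp (ε t i) 2 P := by
  have h := memLp_id_gaussianReal (μ := 0) (v := v) 2
  rw [← hε.law t i] at h
  exact (memLp_map_measure_iff (g := id) aestronglyMeasurable_id
    (hε.measurable t i).aemeasurable).1 (by simpa using h)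

theorem IsGaussianNoise.integral_eq_zero (hε : IsGaussianNoise ε v P) (t : ℕ) (i : Fin N) :
    ∫ ω, ε t i ω ∂P = 0 := by
  have h := integral_map (μ := P) (hε.measurable t i).aemeasurable (f := fun x : ℝ => x)
    (by fun_prop)
  rw [hε.law t i, integral_id_gaussianReal] at h
  exact h.symm

theorem IsGaussianNoise.integral_mul [IsProbabilityMeasure P] (hε : IsGaussianNoise ε v P) (s t : ℕ) (i j : Fin N) :
    ∫ ω, ε s i ω * ε t j ω ∂P = if (s, i) = (t, j) then (v : ℝ) else 0 := by
  split_ifs with h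
  · obtain ⟨rfl, rfl⟩ := Prod.mk.inj h
    have h1 := integral_map (μ := P) (hε.measurable s i).aemeasurable
      (f := fun x : ℝ => x * x) (by fun_prop)
    rw [← h1, hε.law s i]
    have h2 := variance_id_gaussianReal (μ := 0) (v := v)
    rw [variance_of_integral_eq_zero aemeasurable_id (by simp)] at h2
    simpa only [id, sq] using h2
  · have h1 := hε.indep.indepFun h
    have h2 := h1.integral_fun_mul_eq_mul_integral (hε.measurable s i).aestronglyMeasurable
      (hε.measurable t j).aestronglyMeasurable
    rw [h2, hε.integral_eq_zero s i, zero_mul]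

/-- The average noise of a period. -/
def meanNoise (ε : ℕ → Fin N → Ω → ℝ) (t : ℕ) (ω : Ω) : ℝ := (∑ i, ε t i ω) / N

theorem IsGaussianNoise.memLp_meanNoise (hε : IsGaussianNoise ε v P) (t : ℕ) :
    MemLp (meanNoise ε t) 2 P := by
  have h := (memLp_finsetSum Finset.univ fun i _ => hε.memLp t i).mul_const ((N : ℝ)⁻¹)
  have e : meanNoise ε t = fun ω => (∑ i, ε t i ω) * (N : ℝ)⁻¹ := by
    funext ω
    rw [meanNoise, div_eq_mul_inv]
  rw [e]
  exact h

variable [IsProbabilityMeasure P]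

theorem IsGaussianNoise.integral_meanNoise (hε : IsGaussianNoise ε v P) (t : ℕ) :
    ∫ ω, meanNoise ε t ω ∂P = 0 := by
  simp only [meanNoise]
  rw [integral_div, integral_finsetSum _ fun i _ => (hε.memLp t i).integrable (by norm_num),
    Finset.sum_eq_zero fun i _ => hε.integral_eq_zero t i, zero_div]

theorem IsGaussianNoise.integral_meanNoise_mul (hN : 0 < N) (hε : IsGaussianNoise ε v P)
    (s t : ℕ) :
    ∫ ω, meanNoise ε s ω * meanNoise ε t ω ∂P = if s = t then (v : ℝ) / N else 0 := by
  have hN' : (N : ℝ) ≠ 0 := by positivity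
  have h1 : ∀ ω, meanNoise ε s ω * meanNoise ε t ω
      = (∑ i, ∑ j, ε s i ω * ε t j ω) / (N * N) := fun ω => by
    rw [meanNoise, meanNoise, div_mul_div_comm, Finset.sum_mul_sum]
  have hint : ∀ i j, Integrable (fun ω => ε s i ω * ε t j ω) P := fun i j =>
    (hε.memLp s i).integrable_mul (hε.memLp t j)
  simp only [h1]
  rw [integral_div, integral_finsetSum _ fun i _ => integrable_finsetSum _ fun j _ => hint i j,
    Finset.sum_congr rfl fun i _ => integral_finsetSum _ fun j _ => hint i j]
  simp only [hε.integral_mul, Prod.mk.injEq]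
  split_ifs with h
  · simp [h]
    field_simp
  · simp [h]

variable {u : Users N}

theorem memLp_errors (hN : 0 < N) (hβ : ∀ i, 0 < u.β i) (hε : IsGaussianNoise ε v P) (Y : ℝ)
    (d : ℕ → ℝ) (t : ℕ) :
    MemLp (fun ω => interceptError u Y d (fun s j => ε s j ω) t) 2 P
      ∧ MemLp (fun ω => slopeError u Y d (fun s j => ε s j ω) t) 2 P := by
  induction t with
  | zero =>
    simp only [interceptError, slopeError, Finset.range_zero, Finset.sum_empty]
    exact ⟨memLp_const _, memLp_const _⟩
  | succ t ih =>
    have h : MemLp (fun ω => (1 + u.sensitivity) * (interceptError u Y d (fun s j => ε s j ω) t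
        + d t * slopeError u Y d (fun s j => ε s j ω) t) + meanNoise ε t ω) 2 P :=
      ((ih.1.add (ih.2.const_mul _)).const_mul _).add (hε.memLp_meanNoise t)
    simp only [interceptError_succ hN hβ, slopeError_succ hN hβ]
    exact ⟨ih.1.sub (h.const_mul _), ih.2.sub (h.const_mul _)⟩

/-- The pathwise recursions pass to L² classes. The initial errors are deterministic, hence
orthogonal to the centred noise. -/
theorem errorProcess_toLp (hN : 0 < N) (hβ : ∀ i, 0 < u.β i) (hε : IsGaussianNoise ε v P)
    (Y : ℝ) (d : ℕ → ℝ) :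
    ErrorProcess d (1 + u.sensitivity) ((v : ℝ) / N)
      (fun t => (memLp_errors hN hβ hε Y d t).1.toLp _)
      (fun t => (memLp_errors hN hβ hε Y d t).2.toLp _)
      (fun t => (hε.memLp_meanNoise t).toLp _) where
  fst_succ t := by
    have h := memLp_errors hN hβ hε Y d t
    change _ = MemLp.toLp _ (h.1.sub ((((h.1.add (h.2.const_smul (d t))).const_smul
      (1 + u.sensitivity)).add (hε.memLp_meanNoise t)).const_smul
        (gramInvFst d (t + 1) (d t))))
    exact MemLp.toLp_congr _ _ (Filter.Eventually.of_forall fun ω =>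
      interceptError_succ hN hβ Y d _ t)
  snd_succ t := by
    have h := memLp_errors hN hβ hε Y d t
    change _ = MemLp.toLp _ (h.2.sub ((((h.1.add (h.2.const_smul (d t))).const_smul
      (1 + u.sensitivity)).add (hε.memLp_meanNoise t)).const_smul
        (gramInvSnd d (t + 1) (d t))))
    exact MemLp.toLp_congr _ _ (Filter.Eventually.of_forall fun ω =>
      slopeError_succ hN hβ Y d _ t)
  noise s t := by rw [inner_toLp, hε.integral_meanNoise_mul hN]
  fst_zero t := by
    rw [inner_toLp]
    simp only [interceptError, Finset.range_zero, Finset.sum_empty]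
    rw [integral_const_mul, hε.integral_meanNoise, mul_zero]
  snd_zero t := by
    rw [inner_toLp]
    simp only [slopeError, Finset.range_zero, Finset.sum_empty]
    rw [integral_const_mul, hε.integral_meanNoise, mul_zero]

theorem integrable_cost (hε : IsGaussianNoise ε v P) (u : Users N) (Y z : ℝ) (x : Fin N → ℝ)
    (t : ℕ) : Integrable (fun ω => u.cost Y z (fun i => x i + ε t i ω)) P := by
  have hx : ∀ i : Fin N, MemLp (fun ω => x i + ε t i ω) 2 P := fun i =>
    (memLp_const (x i)).add (hε.memLp t i)
  unfold Users.cost Users.userCost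
  refine Integrable.add (integrable_finsetSum _ fun i _ => ?_) ?_
  · exact ((((hx i).integrable_sq).const_mul _).add
      (((hx i).integrable (by norm_num)).const_mul _)).const_mul _
  · refine Integrable.const_mul (MemLp.integrable_sq ?_) _
    exact (memLp_finsetSum _ fun i _ => hx i).sub (memLp_const _)

/-- The gap of a period is proportional to the expected squared price error. -/
theorem integrable_and_gap_eq (hN : 0 < N) (hβ : ∀ i, 0 < u.β i) (hε : IsGaussianNoise ε v P)
    (Y : ℝ) (d : ℕ → ℝ) (t : ℕ) :
    Integrable (onlineCost (leastSquaresPolicy N) u Y d ε t) P ∧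
    Integrable (offlineCost u Y d ε t) P ∧
    gap (leastSquaresPolicy N) u Y d ε P t = N / 2 * (u.sensitivity + u.sensitivity ^ 2)
      * ‖(memLp_errors hN hβ hε Y d t).1.toLp _
        + d t • (memLp_errors hN hβ hε Y d t).2.toLp _‖ ^ 2 := by
  have h := memLp_errors hN hβ hε Y d t
  have hξ := hε.memLp_meanNoise t
  have hρ := h.1.add (h.2.const_smul (d t))
  set ρ : Ω → ℝ := (fun ω => interceptError u Y d (fun s j => ε s j ω) t)
    + d t • (fun ω => slopeError u Y d (fun s j => ε s j ω) t) with hρdef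
  have hoff : Integrable (offlineCost u Y d ε t) P := integrable_cost hε u Y (d t) _ t
  have heq : onlineCost (leastSquaresPolicy N) u Y d ε t = fun ω => offlineCost u Y d ε t ω
      + (N / 2 * (u.sensitivity + u.sensitivity ^ 2) * ρ ω ^ 2
        + N * (1 + u.sensitivity) * (ρ ω * meanNoise ε t ω)) := by
    funext ω
    rw [onlineCost, cost_response_sub hN hβ, onlinePrice_sub_offlinePrice hN hβ]
    rfl
  have hi1 : Integrable (fun ω => N / 2 * (u.sensitivity + u.sensitivity ^ 2) * ρ ω ^ 2) P :=
    hρ.integrable_sq.const_mul _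
  have hi2 : Integrable (fun ω => N * (1 + u.sensitivity) * (ρ ω * meanNoise ε t ω)) P :=
    (hρ.integrable_mul hξ).const_mul _
  refine ⟨?_, hoff, ?_⟩
  · rw [heq]
    exact hoff.add (hi1.add hi2)
  · have horth := (errorProcess_toLp hN hβ hε Y d).inner_residual_noise (le_refl t)
    change inner ℝ (hρ.toLp ρ) (hξ.toLp _) = 0 at horth
    rw [inner_toLp] at horth
    change _ = _ * ‖hρ.toLp ρ‖ ^ 2
    have hsum := (integral_add hoff (hi1.add hi2)).trans
      (congrArg (_ + ·) (integral_add hi1 hi2))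
    rw [integral_const_mul, integral_const_mul, horth] at hsum
    rw [norm_sq_toLp, gap, heq]
    refine (congrArg (· - _) hsum).trans ?_
    ring

end L2

/-! ### From the gaps to the regret -/

theorem exists_log_bounds (k K : ℝ) (n₀ : ℕ) (hk : 0 < k) (hK : 0 < K) :
    ∃ (K₁ K₂ : ℝ) (n₁ : ℕ), 0 < K₁ ∧ 0 < K₂ ∧ ∀ g : ℕ → ℝ, (∀ t, 0 ≤ g t) →
      (∀ t : ℕ, g t ≤ K * (1 / ((t : ℝ) + 1))) →
      (∀ t : ℕ, n₀ ≤ t → k * (1 / ((t : ℝ) + 1)) ≤ g t) →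
      ∀ T : ℕ, n₁ ≤ T → K₁ * Real.log T ≤ ∑ t ∈ Finset.range T, g t ∧
        ∑ t ∈ Finset.range T, g t ≤ K₂ * Real.log T := by
  have hharm : ∀ n : ℕ, ((harmonic n : ℚ) : ℝ) = ∑ t ∈ Finset.range n, 1 / ((t : ℝ) + 1) := by
    intro n
    rw [harmonic]
    push_cast
    simp only [one_div]
  set h₀ : ℝ := ∑ t ∈ Finset.range n₀, 1 / ((t : ℝ) + 1) with hh₀
  have hh₀' : 0 ≤ h₀ := Finset.sum_nonneg fun t _ => by positivity
  -- For T ≥ exp(2h₀ + 1), log T dominates both 2h₀, which absorbs the periods before n₀, and the 1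
  -- in the upper harmonic bound.
  obtain ⟨n₁, hn₁⟩ := exists_nat_ge (Real.exp (2 * h₀ + 1))
  refine ⟨k / 2, 2 * K, max n₀ n₁, by positivity, by positivity, fun g hg hgK hgk T hT => ?_⟩
  have hT0 : n₀ ≤ T := (le_max_left _ _).trans hT
  have hT1 : Real.exp (2 * h₀ + 1) ≤ T :=
    hn₁.trans (by exact_mod_cast (le_max_right n₀ n₁).trans hT)
  have hTpos : (0 : ℝ) < T := (Real.exp_pos _).trans_le hT1
  have hlog : 2 * h₀ + 1 ≤ Real.log T := (Real.le_log_iff_exp_le hTpos).2 hT1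
  constructor
  · have h1 := log_add_one_le_harmonic T
    rw [hharm] at h1
    have h2 : Real.log T ≤ Real.log ((T + 1 : ℕ) : ℝ) :=
      Real.log_le_log hTpos (by push_cast; linarith)
    rw [← Finset.sum_range_add_sum_Ico _ hT0, ← hh₀] at h1
    have h3 : k * ∑ t ∈ Finset.Ico n₀ T, 1 / ((t : ℝ) + 1) ≤ ∑ t ∈ Finset.Ico n₀ T, g t := by
      rw [Finset.mul_sum]
      exact Finset.sum_le_sum fun t ht => hgk t (Finset.mem_Ico.1 ht).1
    have h4 : 0 ≤ ∑ t ∈ Finset.range n₀, g t := Finset.sum_nonneg fun t _ => hg t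
    rw [← Finset.sum_range_add_sum_Ico _ hT0]
    have h5 : k * (Real.log T / 2) ≤ k * ∑ t ∈ Finset.Ico n₀ T, 1 / ((t : ℝ) + 1) := by
      gcongr
      linarith
    linarith
  · have h1 := harmonic_le_one_add_log T
    rw [hharm] at h1
    calc ∑ t ∈ Finset.range T, g t ≤ K * ∑ t ∈ Finset.range T, 1 / ((t : ℝ) + 1) := by
          rw [Finset.mul_sum]
          exact Finset.sum_le_sum fun t _ => hgK t
      _ ≤ K * (2 * Real.log T) := by
          gcongr
          linarith
      _ = 2 * K * Real.log T := by ring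

/-- The unregularized determinant is t² times the empirical variance. The factor 1/4 and the
restriction to t ≥ 1 come from replacing t² by (t + 1)². -/
theorem isExcited_of_targetVariance {d : ℕ → ℝ} {dmin dmax κ : ℝ} {t₀ : ℕ} (hd : 0 < dmin)
    (hκ : 0 < κ) (h1 : ∀ t, d t ∈ Set.Icc dmin dmax)
    (h2 : ∀ t, t₀ ≤ t → κ ≤ targetVariance d t) :
    IsExcited d dmax (κ / 4) (max t₀ 1) where
  bound t := by
    have := h1 t
    rw [abs_of_pos (hd.trans_le this.1)]
    exact this.2
  le_det t ht := by
    have ht1 : (1 : ℝ) ≤ t := by exact_mod_cast (le_max_right t₀ 1).trans ht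
    have h3 := h2 t ((le_max_left t₀ 1).trans ht)
    rw [targetVariance, le_div_iff₀ (by linarith)] at h3
    have h4 : t * ∑ s ∈ Finset.range t, (d s - targetMean d t) ^ 2
        = t * ∑ s ∈ Finset.range t, d s ^ 2 - (∑ s ∈ Finset.range t, d s) ^ 2 := by
      have e : ∀ s, (d s - targetMean d t) ^ 2
          = d s ^ 2 - 2 * targetMean d t * d s + targetMean d t ^ 2 := fun s => by ring
      simp only [e, Finset.sum_add_distrib, Finset.sum_sub_distrib, ← Finset.mul_sum,
        Finset.sum_const, Finset.card_range, nsmul_eq_mul]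
      rw [targetMean]
      field_simp
      ring
    have h5 := mul_le_mul_of_nonneg_left h3 (show (0 : ℝ) ≤ t by linarith)
    rw [h4] at h5
    rw [gramDet_eq]
    have h6 := one_le_secondMoment d t
    have h7 : ((t : ℝ) + 1) ^ 2 ≤ 4 * (t : ℝ) ^ 2 := by nlinarith
    have h8 := mul_le_mul_of_nonneg_left h7 (show 0 ≤ κ / 4 by positivity)
    linarith

end

/-! ### Uniform bounds for the user parameters -/

variable {N : ℕ} {u : Users N} {αmax βmin βmax : ℝ}

theorem Users.sensitivity_le (hβmin : 0 < βmin) (hβ : ∀ i, u.β i ∈ Set.Icc βmin βmax) :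
    u.sensitivity ≤ N / βmin := by
  have h : u.sensitivity ≤ ∑ _i : Fin N, 1 / βmin :=
    Finset.sum_le_sum fun i _ => one_div_le_one_div_of_le hβmin (hβ i).1
  simpa [div_eq_mul_inv] using h

/-- The maximum keeps the constant positive before any users are given, when βmin ≤ βmax is not yet
known. -/
theorem Users.le_sensitivity (hβmin : 0 < βmin) (hβ : ∀ i, u.β i ∈ Set.Icc βmin βmax) :
    N / max βmax βmin ≤ u.sensitivity := by
  have h : ∑ _i : Fin N, 1 / max βmax βmin ≤ u.sensitivity :=
    Finset.sum_le_sum fun i _ => one_div_le_one_div_of_le (hβmin.trans_le (hβ i).1)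
      ((hβ i).2.trans (le_max_left _ _))
  simpa [div_eq_mul_inv] using h

theorem Users.intercept_sq_le (hN : 0 < N) (hβmin : 0 < βmin) (hα : ∀ i, |u.α i| ≤ αmax)
    (hβ : ∀ i, u.β i ∈ Set.Icc βmin βmax) : u.intercept ^ 2 ≤ (αmax / βmin) ^ 2 := by
  have hN' : (0 : ℝ) < N := by exact_mod_cast hN
  have hs := Users.sensitivity_nonneg fun i => hβmin.trans_le (hβ i).1
  have hα0 : 0 ≤ αmax := (abs_nonneg _).trans (hα ⟨0, hN⟩)
  have h1 : |∑ i, u.α i / u.β i| ≤ N * (αmax / βmin) := by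
    have h : |∑ i, u.α i / u.β i| ≤ ∑ _i : Fin N, αmax / βmin := by
      refine (Finset.abs_sum_le_sum_abs _ _).trans (Finset.sum_le_sum fun i _ => ?_)
      rw [abs_div, abs_of_pos (hβmin.trans_le (hβ i).1)]
      exact div_le_div₀ hα0 (hα i) hβmin (hβ i).1
    simpa using h
  have h2 : |u.intercept| ≤ αmax / βmin := by
    rw [Users.intercept, abs_div, abs_of_pos (show (0 : ℝ) < N * (1 + u.sensitivity) by positivity),
      div_le_iff₀ (by positivity)]
    have h3 : 0 ≤ αmax / βmin := by positivity
    have h4 : 0 ≤ αmax / βmin * (N * u.sensitivity) := by positivity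
    linarith
  exact sq_le_sq' (abs_le.1 h2).1 (abs_le.1 h2).2

theorem sq_div_le_sq (hN : 0 < N) {s Y Ymin Ymax : ℝ} (hs : 0 ≤ s) (hY0 : 0 < Ymin)
    (hY : Y ∈ Set.Icc Ymin Ymax) : (Y / (N * (1 + s))) ^ 2 ≤ Ymax ^ 2 := by
  have hN' : (1 : ℝ) ≤ N := by exact_mod_cast hN
  have hYpos := hY0.trans_le hY.1
  have h1 : Y / (N * (1 + s)) ≤ Y := div_le_self hYpos.le (by nlinarith)
  have h2 : 0 ≤ Y / (N * (1 + s)) := by positivity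
  exact pow_le_pow_left₀ h2 (h1.trans hY.2) 2

end DemandResponse

/-! ### The main theorem -/

open DemandResponse in
theorem theorem1 (N : ℕ) (hN : 0 < N) :
    ∃ p : PricingPolicy N,
      ∀ (αmax βmin βmax dmin dmax Ymin Ymax κ : ℝ) (t₀ : ℕ) (v : ℝ≥0),
        0 < βmin → 0 < dmin → 0 < Ymin → 0 < κ → 0 < v →
        ∃ (k₁ k₂ K₁ K₂ : ℝ) (n₀ : ℕ), 0 < k₁ ∧ 0 < k₂ ∧ 0 < K₁ ∧ 0 < K₂ ∧
          ∀ (Ω : Type*) [MeasurableSpace Ω] (P : Measure Ω) [IsProbabilityMeasure P]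
            (ε : ℕ → Fin N → Ω → ℝ) (u : Users N) (Y : ℝ) (d : ℕ → ℝ),
            IsGaussianNoise ε v P →
            (∀ i, |u.α i| ≤ αmax) →
            (∀ i, u.β i ∈ Set.Icc βmin βmax) →
            Y ∈ Set.Icc Ymin Ymax →
            (∀ t, d t ∈ Set.Icc dmin dmax) →
            (∀ t, t₀ ≤ t → κ ≤ targetVariance d t) →
            (∀ t, Integrable (onlineCost p u Y d ε t) P) ∧
            (∀ t, Integrable (offlineCost u Y d ε t) P) ∧
            (∀ t : ℕ, n₀ ≤ t →
              k₁ * (1 / ((t : ℝ) + 1)) ≤ gap p u Y d ε P t ∧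
              gap p u Y d ε P t ≤ k₂ * (1 / ((t : ℝ) + 1))) ∧
            (∀ T : ℕ, n₀ ≤ T →
              K₁ * Real.log T ≤ regret p u Y d ε P T ∧
              regret p u Y d ε P T ≤ K₂ * Real.log T) := by
  refine ⟨leastSquaresPolicy N,
    fun αmax βmin βmax dmin dmax Ymin Ymax κ t₀ v hβmin hdmin hYmin hκ hv => ?_⟩
  have hN' : (0 : ℝ) < N := by exact_mod_cast hN
  have hv' : (0 : ℝ) < v := by exact_mod_cast hv
  -- The gain is at most 1 + N/βmin, the mean noise has variance v/N, and the initial errors are the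
  -- negatives of the two coefficients of the full-information price.
  obtain ⟨k, K, n, hk, hK, hres⟩ := exists_residual_bounds dmax (κ / 4) (1 + N / βmin)
    ((v : ℝ) / N) ((αmax / βmin) ^ 2 + Ymax ^ 2) (max t₀ 1) (by positivity) (by positivity)
  have hmax : 0 < max βmax βmin := hβmin.trans_le (le_max_right _ _)
  set cl : ℝ := N / 2 * (N / max βmax βmin + (N / max βmax βmin) ^ 2) with hcl
  set cu : ℝ := N / 2 * (N / βmin + (N / βmin) ^ 2) with hcu
  have hcl0 : 0 < cl := by positivity
  have hcu0 : 0 < cu := by positivity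
  obtain ⟨K₁, K₂, n₁, hK₁, hK₂, hlog⟩ := exists_log_bounds (cl * k) (cu * K) n (by positivity)
    (by positivity)
  refine ⟨cl * k, cu * K, K₁, K₂, max n n₁, by positivity, by positivity, hK₁, hK₂, ?_⟩
  intro Ω _ P _ ε u Y d hε hα hβ hY hd hspread
  have hβ0 : ∀ i, 0 < u.β i := fun i => hβmin.trans_le (hβ i).1
  have hs0 := Users.sensitivity_nonneg hβ0
  have hsu := Users.sensitivity_le hβmin hβ
  have hsl := Users.le_sensitivity hβmin hβ
  have hgap := integrable_and_gap_eq hN hβ0 hε Y d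
  obtain ⟨hup, hlow⟩ := hres (errorProcess_toLp hN hβ0 hε Y d)
    (isExcited_of_targetVariance hdmin hκ hd hspread) (by linarith) (by linarith) (by
      rw [norm_sq_toLp, norm_sq_toLp]
      simp only [interceptError, slopeError, Finset.range_zero, Finset.sum_empty, sub_zero,
        neg_sq, integral_const, probReal_univ, one_smul]
      exact add_le_add (Users.intercept_sq_le hN hβmin hα hβ) (sq_div_le_sq hN hs0 hYmin hY))
  have hcl' : cl ≤ N / 2 * (u.sensitivity + u.sensitivity ^ 2) := by rw [hcl]; gcongr
  have hcu' : N / 2 * (u.sensitivity + u.sensitivity ^ 2) ≤ cu := by rw [hcu]; gcongr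
  have hnn : ∀ t, 0 ≤ gap (leastSquaresPolicy N) u Y d ε P t := fun t => by
    rw [(hgap t).2.2]; positivity
  have hgu : ∀ t : ℕ, gap (leastSquaresPolicy N) u Y d ε P t ≤ cu * K * (1 / ((t : ℝ) + 1)) :=
    fun t => by
      rw [(hgap t).2.2, mul_assoc cu]
      exact mul_le_mul hcu' (hup t) (by positivity) hcu0.le
  have hgl : ∀ t : ℕ, n ≤ t →
      cl * k * (1 / ((t : ℝ) + 1)) ≤ gap (leastSquaresPolicy N) u Y d ε P t := fun t ht => by
    rw [(hgap t).2.2, mul_assoc cl]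
    exact mul_le_mul hcl' (hlow t ht) (by positivity) (by positivity)
  refine ⟨fun t => (hgap t).1, fun t => (hgap t).2.1,
    fun t ht => ⟨hgl t ((le_max_left _ _).trans ht), hgu t⟩, fun T hT => ?_⟩
  have hregret : regret (leastSquaresPolicy N) u Y d ε P T
      = ∑ t ∈ Finset.range T, gap (leastSquaresPolicy N) u Y d ε P t := by
    rw [regret, integral_finsetSum _ fun t _ => (hgap t).1,
      integral_finsetSum _ fun t _ => (hgap t).2.1, ← Finset.sum_sub_distrib]
    rfl
  rw [hregret]
  exact hlog _ hnn hgu hgl T ((le_max_right _ _).trans hT)
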